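/- Let $m\ge 0$ be an integer and let $\Gamma\subset\mathbb R^2$ be a Jordan curve with a regular parametrization $\mathbf g$ of class $C^{k}$, $k=\max(2,m+1)$, injective on $[\xi_s,\xi_e)$ and extended periodically to $\mathbb R$ with period $\xi_e-\xi_s$ (the extension being regular and $C^{k}$). Let $\boldsymbol\tau=\mathbf g'/\|\mathbf g'\|$, $\mathbf n=\begin{pmatrix}0&1\\-1&0\end{pmatrix}\boldsymbol\tau$, and $P(\eta,\xi)=\mathbf g(\xi)+\eta\,\mathbf n(\xi)$. Let $\rho>0$. There are constants $h_0>0$ and $C>0$, depending only on $m$, $\mathbf g$ and $\rho$, such that the following holds for every closed axis-parallel rectangle $K$ with diameter $h<h_0$, with side lengths at least $\rho h$, and whose interior meets $\Gamma$ (an interface element of a shape-regular rectangular mesh). Let $\mathbf g(c)$ be a point of $\Gamma$ in the interior of $K$ and let $\hat K$ be the set of all $(\eta,\xi)$ with $|\eta|\le h$, $|\xi-c|\le(\xi_e-\xi_s)/2$ and $P(\eta,\xi)\in K$. Then $P$ maps $\hat K$ bijectively onto $K$, so that $\hat K=R(K)$ with $R=P^{-1}$. Let $[\xi_0,\xi_1]$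 be the range of $\xi$ on $\hat K$, so that $\hat K\subset[-h,h]\times[\xi_0,\xi_1]$, and let $\hat\Gamma=\{0\}\times[\xi_0,\xi_1]$. Let $0<\beta^-\le\beta^+$ and put $\hat\beta=\beta^+$ for $\eta>0$, $\hat\beta=\beta^-$ for $\eta<0$. Let $\hat{\mathcal V}^m_\beta(\hat K)$ be the space of functions $\hat\phi$ that coincide with polynomials of degree at most $m$ in each variable on each of the parts $\hat K^\pm=\hat K\cap\{\pm\eta>0\}$ and satisfy, with these polynomials extended to $\hat\Gamma$, $$[\![\hat\phi]\!]_{\hat\Gamma}=0,\qquad [\![\hat\beta\,\partial_\eta\hat\phi]\!]_{\hat\Gamma}=0,\qquad \int_{\hat\Gamma}[\![\hat\beta\,\partial_\eta^j\mathcal L(\hat\phi)]\!]\,v\,d\xi=0$$ for all polynomials $v$ in $\xi$ of degree at most $m$ and all integers $0\le j\le m-2$, where $[\![\cdot]\!]$ is the jump across $\hat\Gamma$ and $\mathcal L$ is the Laplacian in Frenet coordinates, that is, $\mathcal L(u\circ P)=(\Delta u)\circ P$. Then $$\|\hat\beta\,\widehat\nabla\hat\phi\|_{L^2(\partial\hat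 K)}\le C\,\frac{\beta^+}{\sqrt{\beta^-}}\,h^{-1/2}\,\|\sqrt{\hat\beta}\,\widehat\nabla\hat\phi\|_{L^2(\hat K)}\qquad\text{for all }\hat\phi\in\hat{\mathcal V}^m_\beta(\hat K),$$ where $\widehat\nabla$ is the gradient with respect to $(\eta,\xi)$, and where, on the part of $\partial\hat K$ (if any) that lies in $\{\eta=0\}$, the traces from both sides are counted in the left-hand norm. -/

import Mathlib

open MeasureTheory Set

noncomputable section

/-- The Euclidean plane; it carries both the physical coordinates `(x, y)` and the Frenet
coordinates `(η, ξ)`, where `η` is the coordinate `0` and `ξ` is the coordinate `1`. -/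
abbrev Plane : Type := EuclideanSpace ℝ (Fin 2)

/-! ### The Frenet apparatus of a parametrized plane curve -/

/-- Unit tangent `τ = g' / ‖g'‖`. -/
def unitTangent (g : ℝ → Plane) (ξ : ℝ) : Plane := ‖deriv g ξ‖⁻¹ • deriv g ξ

/-- Unit normal `n = [[0, 1], [-1, 0]] τ`. -/
def unitNormal (g : ℝ → Plane) (ξ : ℝ) : Plane := !₂[unitTangent g ξ 1, -unitTangent g ξ 0]

/-- Signed curvature `κ = det (g', g'') / ‖g'‖ ^ 3`. -/
def signedCurvature (g : ℝ → Plane) (ξ : ℝ) : ℝ :=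
  (deriv g ξ 0 * deriv (deriv g) ξ 1 - deriv g ξ 1 * deriv (deriv g) ξ 0) / ‖deriv g ξ‖ ^ 3

/-- The Frenet transformation `P (η, ξ) = g ξ + η n(ξ)`. -/
def frenetMap (g : ℝ → Plane) (x : Plane) : Plane := g (x 1) + x 0 • unitNormal g (x 1)

/-- The Jacobian determinant `J (η, ξ) = ‖g'(ξ)‖ (1 + η κ(ξ))` of the Frenet transformation. -/
def frenetJacobian (g : ℝ → Plane) (η ξ : ℝ) : ℝ :=
  ‖deriv g ξ‖ * (1 + η * signedCurvature g ξ)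

/-- The Laplacian in Frenet coordinates,
`𝓛 u = J⁻¹ (∂_η (J ∂_η u) + ∂_ξ (J⁻¹ ∂_ξ u))`.
It is characterized by `𝓛 (U ∘ P) = (Δ U) ∘ P`, see `frenetLaplacian_comp_frenetMap`. -/
def frenetLaplacian (g : ℝ → Plane) (u : ℝ → ℝ → ℝ) (η ξ : ℝ) : ℝ :=
  (frenetJacobian g η ξ)⁻¹ *
    (deriv (fun s => frenetJacobian g s ξ * deriv (fun r => u r ξ) s) η +
      deriv (fun s => (frenetJacobian g η s)⁻¹ * deriv (fun r => u η r) s) ξ)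

/-- The formula for `𝓛` is the Laplacian read in Frenet coordinates: `𝓛 (U ∘ P) = (Δ U) ∘ P`
wherever `P` is locally invertible. -/
theorem frenetLaplacian_comp_frenetMap {g : ℝ → Plane} (hg : ContDiff ℝ 2 g)
    (hreg : ∀ ξ, deriv g ξ ≠ 0) {U : Plane → ℝ} (hU : ContDiff ℝ 2 U) {η ξ : ℝ}
    (hJ : frenetJacobian g η ξ ≠ 0) :
    frenetLaplacian g (fun s r => U (frenetMap g !₂[s, r])) η ξ =
      Laplacian.laplacian U (frenetMap g !₂[η, ξ]) := by
  have hg1 : ContDiff ℝ 1 (deriv g) := hg.deriv' (n := 1)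
  have hgd : ∀ r, HasDerivAt g (deriv g r) r := fun r =>
    (hg.differentiable (by norm_num) r).hasDerivAt
  have hg2 : ∀ r, HasDerivAt (deriv g) (deriv (deriv g) r) r := fun r =>
    (hg1.differentiable (by norm_num) r).hasDerivAt
  have hpos : ∀ r, 0 < ‖deriv g r‖ := fun r => norm_pos_iff.2 (hreg r)
  have hsq : ∀ r, ‖deriv g r‖ ^ 2 = deriv g r 0 ^ 2 + deriv g r 1 ^ 2 := fun r => by
    simp [EuclideanSpace.norm_sq_eq, Fin.sum_univ_two]
  have hg2i : ∀ i r, HasDerivAt (fun s => deriv g s i) (deriv (deriv g) r i) r := fun i r => by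
    simpa [Function.comp_def] using
      (EuclideanSpace.proj (𝕜 := ℝ) i).hasFDerivAt.comp_hasDerivAt r (hg2 r)
  have hnorm : ∀ r, HasDerivAt (fun s => ‖deriv g s‖)
      ((deriv g r 0 * deriv (deriv g) r 0 + deriv g r 1 * deriv (deriv g) r 1) / ‖deriv g r‖) r := by
    intro r
    have h1 : (fun s => ‖deriv g s‖) = fun s => Real.sqrt (deriv g s 0 ^ 2 + deriv g s 1 ^ 2) := by
      funext s; rw [← hsq, Real.sqrt_sq (hpos s).le]
    have h2 := (((hg2i 0 r).pow 2).add ((hg2i 1 r).pow 2)).sqrt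
      (by simpa [← hsq] using (hpos r).ne')
    rw [h1]
    refine h2.congr_deriv ?_
    rw [show Real.sqrt (((fun s => deriv g s 0) ^ 2 + (fun s => deriv g s 1) ^ 2) r) = ‖deriv g r‖ by
      simp only [Pi.add_apply, Pi.pow_apply]
      rw [← hsq, Real.sqrt_sq (hpos r).le]]
    have := (hpos r).ne'
    push_cast
    field_simp
  -- derivatives of the frame
  have hτ : ∀ r, HasDerivAt (unitTangent g)
      (-(‖deriv g r‖ * signedCurvature g r) • unitNormal g r) r := by
    intro r
    have h := ((hnorm r).inv (hpos r).ne').smul (hg2 r)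
    refine h.congr_deriv ?_
    have h0 := (hpos r).ne'
    have h3 := hsq r
    ext i
    fin_cases i <;>
    · simp [unitNormal, unitTangent, signedCurvature]
      field_simp
      rw [show ‖deriv g r‖ ^ 2 = _ from h3]
      ring
  have hn : ∀ r, HasDerivAt (unitNormal g)
      ((‖deriv g r‖ * signedCurvature g r) • unitTangent g r) r := by
    intro r
    have hi : ∀ i, HasDerivAt (fun s => unitTangent g s i)
        ((-(‖deriv g r‖ * signedCurvature g r) • unitNormal g r) i) r := fun i => by
      simpa [Function.comp_def] using
        (EuclideanSpace.proj (𝕜 := ℝ) i).hasFDerivAt.comp_hasDerivAt r (hτ r)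
    rw [hasDerivAt_iff_hasFDerivAt, ← hasFDerivWithinAt_univ, hasFDerivWithinAt_euclidean]
    intro i
    rw [hasFDerivWithinAt_univ]
    suffices h : HasDerivAt (fun s => unitNormal g s i)
      (((‖deriv g r‖ * signedCurvature g r) • unitTangent g r) i) r by
      refine h.hasFDerivAt.congr_fderiv ?_
      ext; simp
    fin_cases i
    · simpa [unitNormal] using hi 1
    · simpa [unitNormal, Pi.neg_def] using (hi 0).neg
  have hPη : ∀ s r, HasDerivAt (fun t => frenetMap g !₂[t, r]) (unitNormal g r) s := by
    intro s r
    simpa [frenetMap] using ((hasDerivAt_id s).smul_const (unitNormal g r)).const_add (g r)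
  have hPξ : ∀ s r, HasDerivAt (fun t => frenetMap g !₂[s, t])
      (frenetJacobian g s r • unitTangent g r) r := by
    intro s r
    have h := (hgd r).add ((hn r).const_smul s)
    have h' : (g + s • unitNormal g) = fun t => frenetMap g !₂[s, t] := by
      funext t; simp [frenetMap]
    rw [h'] at h
    refine h.congr_deriv ?_
    rw [smul_smul, frenetJacobian, mul_add, mul_one, add_smul]
    congr 1
    · rw [unitTangent, smul_smul, mul_inv_cancel₀ (hpos r).ne', one_smul]
    · congr 1; ring
  -- derivatives of `U ∘ P`
  have hU1 : ∀ x, HasFDerivAt U (fderiv ℝ U x) x := fun x =>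
    (hU.differentiable (by norm_num) x).hasFDerivAt
  have hU2 : ∀ x, HasFDerivAt (fderiv ℝ U) (fderiv ℝ (fderiv ℝ U) x) x := fun x =>
    ((hU.fderiv_right (m := 1) (by norm_num)).differentiable (by norm_num) x).hasFDerivAt
  have huη : ∀ s r, deriv (fun t => U (frenetMap g !₂[t, r])) s =
      fderiv ℝ U (frenetMap g !₂[s, r]) (unitNormal g r) := fun s r =>
    ((hU1 _).comp_hasDerivAt s (hPη s r)).deriv
  have huξ : ∀ s r, deriv (fun t => U (frenetMap g !₂[s, t])) r =
      frenetJacobian g s r * fderiv ℝ U (frenetMap g !₂[s, r]) (unitTangent g r) := fun s r => by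
    simpa [Function.comp_def] using ((hU1 _).comp_hasDerivAt r (hPξ s r)).deriv
  have hJη : HasDerivAt (fun s => frenetJacobian g s ξ)
      (‖deriv g ξ‖ * signedCurvature g ξ) η := by
    simpa [frenetJacobian] using
      (((hasDerivAt_id η).mul_const (signedCurvature g ξ)).const_add 1).const_mul ‖deriv g ξ‖
  have hA := hJη.mul
    (((hU2 _).comp_hasDerivAt η (hPη η ξ)).clm_apply (hasDerivAt_const η (unitNormal g ξ)))
  have hB := ((hU2 _).comp_hasDerivAt ξ (hPξ η ξ)).clm_apply (hτ ξ)
  have hJc : Continuous (fun s => frenetJacobian g η s) := by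
    have c1 := hg1.continuous
    have c2 : Continuous (deriv (deriv g)) := hg1.continuous_deriv (by norm_num)
    unfold frenetJacobian signedCurvature
    have : ∀ s, ‖deriv g s‖ ^ 3 ≠ 0 := fun s => pow_ne_zero _ (hpos s).ne'
    fun_prop (disch := assumption)
  have hev : (fun s => (frenetJacobian g η s)⁻¹ * deriv (fun r => U (frenetMap g !₂[η, r])) s)
      =ᶠ[nhds ξ] fun s => fderiv ℝ U (frenetMap g !₂[η, s]) (unitTangent g s) := by
    filter_upwards [hJc.continuousAt.eventually_ne hJ] with s hs
    rw [huξ, inv_mul_cancel_left₀ hs]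
  -- the Laplacian in the orthonormal frame
  have hon : Orthonormal ℝ ![unitNormal g ξ, unitTangent g ξ] := by
    have h0 := (hpos ξ).ne'
    have h3 := hsq ξ
    have hone : unitTangent g ξ 0 ^ 2 + unitTangent g ξ 1 ^ 2 = 1 := by
      simp [unitTangent]
      field_simp
      linarith
    rw [orthonormal_iff_ite]
    intro i j
    fin_cases i <;> fin_cases j <;>
      simp [-inner_self_eq_norm_sq_to_K, unitNormal,
        PiLp.inner_apply, Fin.sum_univ_two] <;> nlinarith
  let v : OrthonormalBasis (Fin 2) ℝ Plane :=
    OrthonormalBasis.mk hon (by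
      have := hon.linearIndependent.span_eq_top_of_card_eq_finrank (by simp)
      rw [this])
  rw [InnerProductSpace.laplacian_eq_iteratedFDeriv_orthonormalBasis U v]
  simp only [Fin.sum_univ_two, iteratedFDeriv_two_apply]
  have hfun : (fun s => frenetJacobian g s ξ * deriv (fun r => U (frenetMap g !₂[r, ξ])) s) =
      fun s => frenetJacobian g s ξ * fderiv ℝ U (frenetMap g !₂[s, ξ]) (unitNormal g ξ) := by
    funext s; rw [huη]
  have hA' : deriv (fun s => frenetJacobian g s ξ *
      deriv (fun r => U (frenetMap g !₂[r, ξ])) s) η =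
      ‖deriv g ξ‖ * signedCurvature g ξ * fderiv ℝ U (frenetMap g !₂[η, ξ]) (unitNormal g ξ) +
        frenetJacobian g η ξ * fderiv ℝ (fderiv ℝ U) (frenetMap g !₂[η, ξ]) (unitNormal g ξ)
          (unitNormal g ξ) := by
    rw [hfun]; simpa [Pi.mul_def] using hA.deriv
  have hB' : deriv (fun s => (frenetJacobian g η s)⁻¹ *
      deriv (fun r => U (frenetMap g !₂[η, r])) s) ξ =
      frenetJacobian g η ξ * fderiv ℝ (fderiv ℝ U) (frenetMap g !₂[η, ξ]) (unitTangent g ξ)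
          (unitTangent g ξ) -
        ‖deriv g ξ‖ * signedCurvature g ξ *
          fderiv ℝ U (frenetMap g !₂[η, ξ]) (unitNormal g ξ) := by
    rw [hev.deriv_eq]; simpa [sub_eq_add_neg] using hB.deriv
  rw [frenetLaplacian, hA', hB']
  simp [v]
  field_simp
  ring

/-! ### Elements -/

/-- The closed axis-parallel rectangle `[a₀, b₀] × [a₁, b₁]`. -/
def rectangle (a b : Plane) : Set Plane := {x | ∀ i, x i ∈ Icc (a i) (b i)}

/-- The Frenet element `K̂ = R(K)`, where `R` is the inverse of the Frenet transformation `P` of a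
closed curve with parameter period `L`, on the strip `|η| ≤ diam K` over one parameter period. The
period is centred at a parameter `c` for which `g c` lies in `K`, so that `K̂` is not cut in two by
the ends of the parameter interval. -/
def frenetElement (g : ℝ → Plane) (L c : ℝ) (K : Set Plane) : Set Plane :=
  {x | |x 0| ≤ Metric.diam K ∧ |x 1 - c| ≤ L / 2 ∧ frenetMap g x ∈ K}

/-- `ξ₀`: the left end of the `ξ`-range of `K̂`. -/
def xiLeft (Khat : Set Plane) : ℝ := sInf ((fun x : Plane => x 1) '' Khat)

/-- `ξ₁`: the right end of the `ξ`-range of `K̂`. The rectangle `[-h, h] × [ξ₀, ξ₁]` is the Frenet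
fictitious element, and `{0} × [ξ₀, ξ₁]` is its part of the (straightened) interface. -/
def xiRight (Khat : Set Plane) : ℝ := sSup ((fun x : Plane => x 1) '' Khat)

/-! ### Piecewise polynomial Frenet IFE functions -/

/-- A bivariate polynomial (variable `0` is `η`, variable `1` is `ξ`) as a function of `η, ξ`. -/
def polyFun (p : MvPolynomial (Fin 2) ℝ) (η ξ : ℝ) : ℝ := MvPolynomial.eval ![η, ξ] p

/-- The gradient of a bivariate polynomial. -/
def polyGrad (p : MvPolynomial (Fin 2) ℝ) (x : Plane) : Plane :=
  !₂[polyFun (MvPolynomial.pderiv 0 p) (x 0) (x 1), polyFun (MvPolynomial.pderiv 1 p) (x 0) (x 1)]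

/-- The pair `(pm, pp)` is an element of the local Frenet IFE space of degree `m`: the function that
equals `pm` where `η < 0` and `pp` where `η > 0` is piecewise in `Q^m` (degree at most `m` in each
variable), and across `{0} × [ξ₀, ξ₁]` it satisfies the conditions
`⟦φ⟧ = 0`, `⟦β ∂_η φ⟧ = 0`, and `⟦β ∂_η^j 𝓛 φ⟧` is `L²`-orthogonal to all polynomials of degree at
most `m` in `ξ` for `0 ≤ j ≤ m - 2`. -/
structure IsFrenetIFE (g : ℝ → Plane) (m : ℕ) (βm βp ξ₀ ξ₁ : ℝ)
    (pm pp : MvPolynomial (Fin 2) ℝ) : Prop where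
  mem_minus : pm ∈ MvPolynomial.restrictDegree (Fin 2) ℝ m
  mem_plus : pp ∈ MvPolynomial.restrictDegree (Fin 2) ℝ m
  jump_value : ∀ ξ ∈ Icc ξ₀ ξ₁, polyFun pp 0 ξ - polyFun pm 0 ξ = 0
  jump_flux : ∀ ξ ∈ Icc ξ₀ ξ₁,
    βp * polyFun (MvPolynomial.pderiv 0 pp) 0 ξ - βm * polyFun (MvPolynomial.pderiv 0 pm) 0 ξ = 0
  jump_laplacian : ∀ j : ℕ, j + 2 ≤ m → ∀ v : Polynomial ℝ, v.natDegree ≤ m →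
    ∫ ξ in ξ₀..ξ₁,
      (βp * iteratedDeriv j (fun η => frenetLaplacian g (polyFun pp) η ξ) 0 -
        βm * iteratedDeriv j (fun η => frenetLaplacian g (polyFun pm) η ξ) 0) * v.eval ξ = 0

/-- The broken norm `‖w ∇φ‖_{L²(μ)}` of the weighted gradient of the function that equals `pm`
where `η < 0` and `pp` where `η > 0`, with weight `wm` where `η < 0` and `wp` where `η > 0`.
If `μ` charges the line `η = 0`, then the traces from both sides are counted there. -/
def brokenGradNorm (μ : Measure Plane) (wm wp : ℝ) (pm pp : MvPolynomial (Fin 2) ℝ) : ENNReal :=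
  (∫⁻ x in {x : Plane | x 0 ≤ 0}, ‖wm • polyGrad pm x‖ₑ ^ 2 ∂μ +
    ∫⁻ x in {x : Plane | 0 ≤ x 0}, ‖wp • polyGrad pp x‖ₑ ^ 2 ∂μ) ^ (1 / 2 : ℝ)

end

/-! The key object is the single polynomial `q = β⁺φ⁺ - β⁻φ⁻`, both pieces being extended to the
whole fictitious element. Write `q = ∑ ηⁱ qᵢ(ξ)`. Continuity of `φ` gives `∂_ξ q = (β⁺ - β⁻) ∂_ξ φ`
on the interface, and the flux condition gives `q₁ = 0`. In nondivergence form the Frenet Laplacian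
is `∂_η²` plus lower-order terms in `η` whose coefficients depend only on the curve. The remaining
jump conditions therefore say that `(j+2)! q_{j+2}` is minus the `L²` projection of a combination of
`q_{i+1}`, `qᵢ'` and `qᵢ''` with `i ≤ j`. Inverse estimates on an interval of length comparable to
`h` then bound `∇q` on the fictitious element by `C max |∂_ξ q(0, ·)|`, with `C` independent of `β`
(`exists_coeff_recursion_bound`, `exists_gradient_sub_le`). So a bound `G` for the gradient of
either piece yields the bound `(C + 1) β⁺ G` for both weighted gradients (`weighted_gradient_le`).

It remains to find one piece that the energy controls. For small `h` the Frenet map is bi-Lipschitz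
near the element, so `K̂` contains a square of side comparable to `h` lying in one closed
half-plane, and `∂K̂` has length at most `Θ h` (`exists_frenetElement_geometry`). Polynomial norm
equivalence gives `G² ≤ C h⁻² ∫ |∇p|²` over that square for the corresponding piece `p`
(`exists_polyFun_sq_le`). Multiplying by `(β⁺)²` and the boundary length, and using `β ≥ β⁻` for the
weight of that piece, gives the factor `(β⁺)² / (β⁻ h)`, the square of the one claimed. -/

/-! ### Norm equivalence and inverse estimates for polynomials in one variable. -/

theorem exists_coeff_sq_le_integral (m : ℕ) : ∃ C > 0, ∀ p : Polynomial ℝ, p.natDegree ≤ m →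
    ∀ i, p.coeff i ^ 2 ≤ C * ∫ t in (0 : ℝ)..1, p.eval t ^ 2 := by
  let P : (Fin (m + 1) → ℝ) → Polynomial ℝ := fun a => ∑ i : Fin (m + 1), Polynomial.monomial i (a i)
  have hPe : ∀ a t, (P a).eval t = ∑ i : Fin (m + 1), a i * t ^ (i : ℕ) := fun a t => by
    simp [P, Polynomial.eval_finsetSum, Polynomial.eval_monomial]
  have hPc : ∀ a (i : Fin (m + 1)), (P a).coeff i = a i := fun a i => by
    simp [P, Polynomial.coeff_monomial, Fin.val_inj]
  let Q : (Fin (m + 1) → ℝ) → ℝ := fun a => ∫ t in (0 : ℝ)..1, (P a).eval t ^ 2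
  have hQc : Continuous Q := by
    apply intervalIntegral.continuous_parametric_intervalIntegral_of_continuous'
    simp only [Function.uncurry_def, hPe]
    fun_prop
  have hQpos : ∀ a, a ≠ 0 → 0 < Q a := by
    intro a ha
    have hP0 : P a ≠ 0 := fun h => ha (by ext i; rw [← hPc a i, h]; simp)
    have hex : ∃ t ∈ Icc (0 : ℝ) 1, (P a).eval t ≠ 0 := by
      by_contra! hcon
      exact hP0 (Polynomial.eq_zero_of_infinite_isRoot _
        ((Icc_infinite (zero_lt_one (α := ℝ))).mono fun t ht => hcon t ht))
    obtain ⟨t, ht, hne⟩ := hex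
    exact intervalIntegral.integral_pos zero_lt_one (by fun_prop) (fun _ _ => sq_nonneg _)
      ⟨t, ht, by positivity⟩
  have hQs : ∀ (r : ℝ) a, Q (r • a) = r ^ 2 * Q a := fun r a => by
    simp only [Q, hPe]
    rw [← intervalIntegral.integral_const_mul]
    congr 1; ext t
    rw [← mul_pow, Finset.mul_sum]
    simp [mul_assoc]
  -- Compactness in the finite-dimensional coefficient space: `Q` is continuous, homogeneous of
  -- degree two and positive off the origin, so its minimum on the unit sphere is positive.
  obtain ⟨a₀, ha₀, hmin⟩ := (isCompact_sphere (0 : Fin (m + 1) → ℝ) 1).exists_isMinOn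
    (NormedSpace.sphere_nonempty.2 zero_le_one) hQc.continuousOn
  have hμ : 0 < Q a₀ := hQpos a₀ (by rintro rfl; simp at ha₀)
  refine ⟨(Q a₀)⁻¹, inv_pos.2 hμ, fun p hp i => ?_⟩
  let a : Fin (m + 1) → ℝ := fun i => p.coeff i
  have hPa : P a = p := by
    rw [p.as_sum_range' (m + 1) (by omega), Finset.sum_range]
  have hint : ∫ t in (0 : ℝ)..1, p.eval t ^ 2 = Q a := by simp only [Q, hPa]
  rw [hint, inv_mul_eq_div, le_div_iff₀ hμ]
  have hkey : ‖a‖ ^ 2 * Q a₀ ≤ Q a := by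
    rcases eq_or_ne a 0 with h0 | h0
    · rw [h0, norm_zero]
      have : Q 0 = 0 := by simpa using hQs 0 0
      simp [this]
    · have hn : ‖a‖ ≠ 0 := norm_ne_zero_iff.2 h0
      have h1 : Q a₀ ≤ Q (‖a‖⁻¹ • a) :=
        isMinOn_iff.1 hmin _ (by simp [norm_smul, hn])
      rw [hQs] at h1
      calc ‖a‖ ^ 2 * Q a₀ ≤ ‖a‖ ^ 2 * (‖a‖⁻¹ ^ 2 * Q a) := by gcongr
        _ = Q a := by field_simp
  refine le_trans ?_ hkey
  gcongr ?_ * _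
  by_cases hi : i < m + 1
  · rw [sq_le_sq, abs_norm]
    exact norm_le_pi_norm a ⟨i, hi⟩
  · rw [Polynomial.coeff_eq_zero_of_natDegree_lt (by omega), zero_pow two_ne_zero]
    positivity

/-- The polynomial `s ↦ p (a + r s)`. -/
noncomputable def Polynomial.rescale (p : Polynomial ℝ) (a r : ℝ) : Polynomial ℝ :=
  p.comp (Polynomial.C a + Polynomial.C r * Polynomial.X)

theorem Polynomial.eval_rescale (p : Polynomial ℝ) (a r s : ℝ) :
    (p.rescale a r).eval s = p.eval (a + r * s) := by
  simp [Polynomial.rescale, Polynomial.eval_comp]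

theorem Polynomial.natDegree_rescale_le (p : Polynomial ℝ) (a r : ℝ) :
    (p.rescale a r).natDegree ≤ p.natDegree := by
  refine Polynomial.natDegree_comp_le.trans ?_
  have : (Polynomial.C a + Polynomial.C r * Polynomial.X).natDegree ≤ 1 := by compute_degree
  simpa using Nat.mul_le_mul_left p.natDegree this

theorem Polynomial.integral_rescale_sq (p : Polynomial ℝ) (a : ℝ) {r : ℝ} (hr : r ≠ 0) :
    ∫ s in (0 : ℝ)..1, (p.rescale a r).eval s ^ 2 = r⁻¹ * ∫ t in a..a + r, p.eval t ^ 2 := by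
  simp only [Polynomial.eval_rescale]
  rw [intervalIntegral.integral_comp_add_mul (fun t => p.eval t ^ 2) hr a]
  simp

theorem abs_eval_le_of_coeff {m : ℕ} {p : Polynomial ℝ} (hp : p.natDegree ≤ m) {B T t : ℝ}
    (hB : ∀ i, |p.coeff i| ≤ B) (ht : |t| ≤ T) :
    |p.eval t| ≤ B * ∑ i ∈ Finset.range (m + 1), T ^ i := by
  rw [Polynomial.eval_eq_sum_range' (Nat.lt_succ_of_le hp), Finset.mul_sum]
  refine (Finset.abs_sum_le_sum_abs _ _).trans (Finset.sum_le_sum fun i _ => ?_)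
  rw [abs_mul, abs_pow]
  have := (abs_nonneg _).trans (hB i)
  gcongr
  exact hB i

/-- A polynomial is bounded, at points comparably close to an interval, by its mean square on that
interval. -/
theorem exists_eval_sq_le_integral (m : ℕ) {T : ℝ} (hT : 0 ≤ T) :
    ∃ C > 0, ∀ p : Polynomial ℝ, p.natDegree ≤ m → ∀ a r t : ℝ, 0 < r → |t - a| ≤ T * r →
      p.eval t ^ 2 ≤ C / r * ∫ s in a..a + r, p.eval s ^ 2 := by
  obtain ⟨C, hC, h⟩ := exists_coeff_sq_le_integral m
  set S := ∑ i ∈ Finset.range (m + 1), T ^ i with hS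
  have hSpos : 0 < S := by
    rw [hS, Finset.sum_range_succ']
    have : 0 ≤ ∑ i ∈ Finset.range m, T ^ (i + 1) := by positivity
    simp; linarith
  refine ⟨C * S ^ 2, by positivity, fun p hp a r t hr ht => ?_⟩
  set I := ∫ s in a..a + r, p.eval s ^ 2 with hI
  have hI0 : 0 ≤ I := intervalIntegral.integral_nonneg (by linarith) fun _ _ => sq_nonneg _
  have hdeg := (p.natDegree_rescale_le a r).trans hp
  -- Rescaling moves the interval to `[0, 1]`; the Jacobian of this change of variable produces the
  -- factor `1 / r`.
  have hco : ∀ i, |(p.rescale a r).coeff i| ≤ Real.sqrt (C * (r⁻¹ * I)) := fun i => by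
    apply Real.abs_le_sqrt
    have := h _ hdeg i
    rwa [p.integral_rescale_sq a hr.ne'] at this
  have ht' : |(t - a) / r| ≤ T := by rwa [abs_div, abs_of_pos hr, div_le_iff₀ hr]
  have h1 := abs_eval_le_of_coeff hdeg hco ht'
  rw [Polynomial.eval_rescale, mul_div_cancel₀ _ hr.ne', add_sub_cancel] at h1
  rw [← sq_abs]
  calc |p.eval t| ^ 2 ≤ (Real.sqrt (C * (r⁻¹ * I)) * S) ^ 2 := by gcongr
    _ = C * S ^ 2 / r * I := by
      rw [mul_pow, Real.sq_sqrt (by positivity)]; field_simp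

/-- With extended nonnegative integrals the estimate can be iterated over the two sides of a square
without integrability conditions. -/
theorem exists_eval_sq_le_lintegral (m : ℕ) {T : ℝ} (hT : 0 ≤ T) :
    ∃ C > 0, ∀ p : Polynomial ℝ, p.natDegree ≤ m → ∀ a r t : ℝ, 0 < r → |t - a| ≤ T * r →
      ENNReal.ofReal (p.eval t ^ 2) ≤
        ENNReal.ofReal (C / r) * ∫⁻ s in Icc a (a + r), ENNReal.ofReal (p.eval s ^ 2) := by
  obtain ⟨C, hC, h⟩ := exists_eval_sq_le_integral m hT
  refine ⟨C, hC, fun p hp a r t hr ht => ?_⟩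
  have hc : Continuous fun s => p.eval s ^ 2 := by fun_prop
  rw [← ofReal_integral_eq_lintegral_ofReal
    (hc.integrableOn_Icc) (Filter.Eventually.of_forall fun _ => sq_nonneg _),
    ← ENNReal.ofReal_mul (by positivity), integral_Icc_eq_integral_Ioc,
    ← intervalIntegral.integral_of_le (by linarith)]
  exact ENNReal.ofReal_le_ofReal (h p hp a r t hr ht)

/-- Inverse estimate. -/
theorem exists_derivative_le (m : ℕ) : ∃ C > 0, ∀ p : Polynomial ℝ, p.natDegree ≤ m →
    ∀ a b B : ℝ, a < b → (∀ t ∈ Icc a b, |p.eval t| ≤ B) →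
      ∀ t ∈ Icc a b, |p.derivative.eval t| ≤ C / (b - a) * B := by
  obtain ⟨C, hC, h⟩ := exists_coeff_sq_le_integral m
  refine ⟨Real.sqrt C * (m + 1) * ∑ i ∈ Finset.range (m + 1), (1 : ℝ) ^ i,
    by simp only [one_pow, Finset.sum_const, Finset.card_range, nsmul_eq_mul]; positivity,
    fun p hp a b B hab hB t ht => ?_⟩
  have hr : 0 < b - a := sub_pos.2 hab
  have hB0 : 0 ≤ B := (abs_nonneg _).trans (hB t ht)
  -- On `[0, 1]` the sup norm controls the mean square, hence the coefficients of `q`, hence `q'`.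
  -- Undoing the scaling yields `1 / (b - a)`.
  set q := p.rescale a (b - a) with hq
  have hdeg : q.natDegree ≤ m := (p.natDegree_rescale_le a _).trans hp
  have hint : ∫ s in (0 : ℝ)..1, q.eval s ^ 2 ≤ B ^ 2 := by
    have : ∫ s in (0 : ℝ)..1, q.eval s ^ 2 ≤ ∫ s in (0 : ℝ)..1, B ^ 2 := by
      refine intervalIntegral.integral_mono_on zero_le_one
        (Continuous.intervalIntegrable (by fun_prop) _ _)
        (Continuous.intervalIntegrable (by fun_prop) _ _) fun s hs => ?_
      rw [hq, Polynomial.eval_rescale, sq_le_sq, abs_of_nonneg hB0]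
      apply hB
      constructor <;> nlinarith [hs.1, hs.2]
    simpa using this
  have hco : ∀ i, |q.coeff i| ≤ Real.sqrt C * B := fun i => by
    rw [← Real.sqrt_sq hB0, ← Real.sqrt_mul hC.le]
    apply Real.abs_le_sqrt
    exact (h q hdeg i).trans (by gcongr)
  have hco' : ∀ i, |q.derivative.coeff i| ≤ Real.sqrt C * B * (m + 1) := fun i => by
    rw [Polynomial.coeff_derivative, abs_mul]
    by_cases hi : i < m
    · have : |((i : ℝ) + 1)| ≤ m + 1 := by
        rw [abs_of_nonneg (by positivity)]; gcongr
      gcongr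
      exact hco _
    · rw [Polynomial.coeff_eq_zero_of_natDegree_lt (by omega)]
      simp; positivity
  have hs : |(t - a) / (b - a)| ≤ 1 := by
    rw [abs_div, abs_of_pos hr, div_le_one hr, abs_of_nonneg (by linarith [ht.1])]
    linarith [ht.2]
  have h1 := abs_eval_le_of_coeff (m := m)
    ((q.natDegree_derivative_le).trans ((Nat.sub_le _ _).trans hdeg)) hco' hs
  have h2 : q.derivative.eval ((t - a) / (b - a)) = (b - a) * p.derivative.eval t := by
    rw [hq, Polynomial.rescale, Polynomial.derivative_comp]
    simp [Polynomial.eval_comp, mul_div_cancel₀ _ hr.ne']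
  rw [h2, abs_mul, abs_of_pos hr] at h1
  rw [div_mul_eq_mul_div, le_div_iff₀ hr]
  linarith

/-- A polynomial that represents a bounded function against itself is bounded. -/
theorem exists_abs_le_of_integral_add_mul_eq_zero (m : ℕ) : ∃ C > 0, ∀ p : Polynomial ℝ,
    p.natDegree ≤ m → ∀ (a b B k : ℝ) (R : ℝ → ℝ), a < b → 1 ≤ k → Continuous R →
      (∀ t ∈ Icc a b, |R t| ≤ B) → ∫ t in a..b, (k * p.eval t + R t) * p.eval t = 0 →
      ∀ t ∈ Icc a b, |p.eval t| ≤ C * B := by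
  obtain ⟨C, hC, h⟩ := exists_eval_sq_le_integral m (zero_le_one (α := ℝ))
  refine ⟨C, hC, fun p hp a b B k R hab hk hRc hR hint => ?_⟩
  have hr : 0 < b - a := sub_pos.2 hab
  obtain ⟨t₀, ht₀, hmax⟩ := isCompact_Icc.exists_isMaxOn (nonempty_Icc.2 hab.le)
    (f := fun t => |p.eval t|) (by fun_prop)
  have hB0 : 0 ≤ B := (abs_nonneg _).trans (hR t₀ ht₀)
  set S := |p.eval t₀| with hS
  have hle : ∀ t ∈ Icc a b, |p.eval t| ≤ S := fun t ht => isMaxOn_iff.1 hmax t ht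
  have h1 := h p hp a (b - a) t₀ hr (by
    rw [one_mul, abs_of_nonneg (by linarith [ht₀.1])]; linarith [ht₀.2])
  rw [add_sub_cancel, ← sq_abs] at h1
  -- The orthogonality gives `k ∫ p² = -∫ R p ≤ (b - a) B S` with `S = max |p|`, while `S² ≤ C / (b
  -- - a) ∫ p²`. Since `k ≥ 1`, one factor `S` cancels and the constant does not depend on `k`.
  have h2 : k * ∫ t in a..b, p.eval t ^ 2 = ∫ t in a..b, -(R t * p.eval t) := by
    have : ∫ t in a..b, (k * p.eval t + R t) * p.eval t =
        (k * ∫ t in a..b, p.eval t ^ 2) + ∫ t in a..b, R t * p.eval t := by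
      rw [← intervalIntegral.integral_const_mul, ← intervalIntegral.integral_add]
      · congr 1; ext t; ring
      · exact Continuous.intervalIntegrable (by fun_prop) _ _
      · exact Continuous.intervalIntegrable (by fun_prop) _ _
    rw [intervalIntegral.integral_neg]; linarith
  have h3 : ∫ t in a..b, -(R t * p.eval t) ≤ ∫ t in a..b, B * S := by
    refine intervalIntegral.integral_mono_on hab.le
        (Continuous.intervalIntegrable (by fun_prop) _ _)
        (Continuous.intervalIntegrable (by fun_prop) _ _) fun s hs => ?_
    refine (neg_le_abs _).trans ?_
    rw [abs_mul]
    gcongr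
    · exact hR s hs
    · exact hle s hs
  have h0 : 0 ≤ ∫ t in a..b, p.eval t ^ 2 :=
    intervalIntegral.integral_nonneg hab.le fun _ _ => sq_nonneg _
  have h4 : ∫ t in a..b, p.eval t ^ 2 ≤ (b - a) * (B * S) := by
    simp only [intervalIntegral.integral_const, smul_eq_mul] at h3
    nlinarith
  have h5 : S ^ 2 ≤ C * B * S := by
    refine h1.trans ?_
    calc C / (b - a) * ∫ t in a..b, p.eval t ^ 2 ≤ C / (b - a) * ((b - a) * (B * S)) := by gcongr
      _ = C * B * S := by field_simp
  have hS0 : 0 ≤ S := abs_nonneg _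
  have h6 : S ≤ C * B := by
    rcases hS0.eq_or_lt with h | h
    · rw [← h]; positivity
    · nlinarith
  exact fun t ht => (hle t ht).trans h6

/-! ### Bivariate polynomials expanded in powers of `η`. -/

/-- The coefficient of `η ^ i` in a bivariate polynomial of degree at most `m` in `ξ`, as a
polynomial in `ξ`. -/
noncomputable def etaCoeff (m : ℕ) (p : MvPolynomial (Fin 2) ℝ) (i : ℕ) : Polynomial ℝ :=
  ∑ k ∈ Finset.range (m + 1),
    Polynomial.monomial k (p.coeff (Finsupp.single 0 i + Finsupp.single 1 k))

theorem natDegree_etaCoeff_le (m : ℕ) (p : MvPolynomial (Fin 2) ℝ) (i : ℕ) :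
    (etaCoeff m p i).natDegree ≤ m := by
  refine Polynomial.natDegree_sum_le_of_forall_le _ _ fun k hk => ?_
  exact (Polynomial.natDegree_monomial_le _).trans (Nat.lt_succ_iff.1 (Finset.mem_range.1 hk))

theorem polyFun_eq_sum {m : ℕ} {p : MvPolynomial (Fin 2) ℝ}
    (hp : p ∈ MvPolynomial.restrictDegree (Fin 2) ℝ m) (η ξ : ℝ) :
    polyFun p η ξ = ∑ i ∈ Finset.range (m + 1), η ^ i * (etaCoeff m p i).eval ξ := by
  classical
  have hinj : Set.InjOn (fun x : ℕ × ℕ => (Finsupp.single (0 : Fin 2) x.1 + Finsupp.single 1 x.2))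
      (Finset.range (m + 1) ×ˢ Finset.range (m + 1) : Finset (ℕ × ℕ)) := by
    intro x _ y _ hxy
    have h0 := DFunLike.congr_fun hxy 0
    have h1 := DFunLike.congr_fun hxy 1
    simp at h0 h1
    exact Prod.ext h0 h1
  have hsub : p.support ⊆ (Finset.range (m + 1) ×ˢ Finset.range (m + 1)).image
      (fun x : ℕ × ℕ => (Finsupp.single (0 : Fin 2) x.1 + Finsupp.single 1 x.2)) := by
    intro s hs
    have hd := (MvPolynomial.mem_restrictDegree _ _ _).1 hp s hs
    refine Finset.mem_image.2 ⟨(s 0, s 1), ?_, ?_⟩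
    · simp only [Finset.mem_product, Finset.mem_range]
      exact ⟨Nat.lt_succ_of_le (hd 0), Nat.lt_succ_of_le (hd 1)⟩
    · ext j; fin_cases j <;> simp
  rw [polyFun, MvPolynomial.eval_eq', Finset.sum_subset hsub, Finset.sum_image hinj,
    Finset.sum_product]
  · refine Finset.sum_congr rfl fun i _ => ?_
    simp only [etaCoeff, Polynomial.eval_finsetSum, Polynomial.eval_monomial, Finset.mul_sum]
    refine Finset.sum_congr rfl fun k _ => ?_
    simp [Fin.prod_univ_two]
    ring
  · intro s _ hs
    simp [MvPolynomial.notMem_support_iff.1 hs]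

theorem hasDerivAt_polyFun_zero (p : MvPolynomial (Fin 2) ℝ) (η ξ : ℝ) :
    HasDerivAt (fun s => polyFun p s ξ) (polyFun (MvPolynomial.pderiv 0 p) η ξ) η := by
  induction p using MvPolynomial.induction_on with
  | C a => simpa [polyFun] using hasDerivAt_const η a
  | add p q hp hq => simpa [polyFun] using hp.fun_add hq
  | mul_X p i hp =>
    fin_cases i
    · have := hp.mul (hasDerivAt_id η)
      simp only [polyFun, Pi.mul_def, id] at this ⊢
      refine (this.congr_deriv ?_).congr_of_eventuallyEq (.of_forall fun s => by simp)
      simp [MvPolynomial.pderiv_X]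
      ring
    · have := hp.mul_const ξ
      simp only [polyFun] at this ⊢
      refine (this.congr_deriv ?_).congr_of_eventuallyEq (.of_forall fun s => by simp)
      simp [MvPolynomial.pderiv_X]
      ring

theorem hasDerivAt_polyFun_one (p : MvPolynomial (Fin 2) ℝ) (η ξ : ℝ) :
    HasDerivAt (fun s => polyFun p η s) (polyFun (MvPolynomial.pderiv 1 p) η ξ) ξ := by
  induction p using MvPolynomial.induction_on with
  | C a => simpa [polyFun] using hasDerivAt_const ξ a
  | add p q hp hq => simpa [polyFun] using hp.fun_add hq
  | mul_X p i hp =>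
    fin_cases i
    · have := hp.mul_const η
      simp only [polyFun] at this ⊢
      refine (this.congr_deriv ?_).congr_of_eventuallyEq (.of_forall fun s => by simp)
      simp [MvPolynomial.pderiv_X]
      ring
    · have := hp.mul (hasDerivAt_id ξ)
      simp only [polyFun, Pi.mul_def, id] at this ⊢
      refine (this.congr_deriv ?_).congr_of_eventuallyEq (.of_forall fun s => by simp)
      simp [MvPolynomial.pderiv_X]
      ring

/-- The polynomial `η ↦ polyFun p η ξ`. -/
noncomputable def etaPoly (m : ℕ) (p : MvPolynomial (Fin 2) ℝ) (ξ : ℝ) : Polynomial ℝ :=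
  ∑ i ∈ Finset.range (m + 1), Polynomial.monomial i ((etaCoeff m p i).eval ξ)

theorem etaCoeff_eq_zero {m : ℕ} {p : MvPolynomial (Fin 2) ℝ}
    (hp : p ∈ MvPolynomial.restrictDegree (Fin 2) ℝ m) {i : ℕ} (hi : m < i) :
    etaCoeff m p i = 0 := by
  refine Finset.sum_eq_zero fun k _ => ?_
  rw [MvPolynomial.notMem_support_iff.1 (fun hs => ?_), Polynomial.monomial_zero_right]
  have := (MvPolynomial.mem_restrictDegree _ _ _).1 hp _ hs 0
  simp at this
  omega

theorem coeff_etaPoly {m : ℕ} {p : MvPolynomial (Fin 2) ℝ}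
    (hp : p ∈ MvPolynomial.restrictDegree (Fin 2) ℝ m) (ξ : ℝ) (i : ℕ) :
    (etaPoly m p ξ).coeff i = (etaCoeff m p i).eval ξ := by
  simp only [etaPoly, Polynomial.finsetSum_coeff, Polynomial.coeff_monomial]
  rw [Finset.sum_ite_eq']
  split_ifs with h
  · rfl
  · rw [etaCoeff_eq_zero hp (by simpa using h)]; simp

theorem eval_etaPoly {m : ℕ} {p : MvPolynomial (Fin 2) ℝ}
    (hp : p ∈ MvPolynomial.restrictDegree (Fin 2) ℝ m) (η ξ : ℝ) :
    (etaPoly m p ξ).eval η = polyFun p η ξ := by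
  simp [polyFun_eq_sum hp, etaPoly, Polynomial.eval_finsetSum, Polynomial.eval_monomial, mul_comm]

theorem natDegree_etaPoly_le (m : ℕ) (p : MvPolynomial (Fin 2) ℝ) (ξ : ℝ) :
    (etaPoly m p ξ).natDegree ≤ m :=
  Polynomial.natDegree_sum_le_of_forall_le _ _ fun _ hk =>
    (Polynomial.natDegree_monomial_le _).trans (Nat.lt_succ_iff.1 (Finset.mem_range.1 hk))

theorem pderiv_mem_restrictDegree {m : ℕ} {p : MvPolynomial (Fin 2) ℝ}
    (hp : p ∈ MvPolynomial.restrictDegree (Fin 2) ℝ m) (i : Fin 2) :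
    MvPolynomial.pderiv i p ∈ MvPolynomial.restrictDegree (Fin 2) ℝ m := by
  rw [MvPolynomial.mem_restrictDegree] at hp ⊢
  intro s hs j
  rw [MvPolynomial.mem_support_iff, MvPolynomial.coeff_pderiv] at hs
  have h := hp (s + Finsupp.single i 1) (MvPolynomial.mem_support_iff.2 (left_ne_zero_of_mul hs)) j
  rw [Finsupp.add_apply] at h
  omega

theorem etaCoeff_pderiv_zero (m : ℕ) (p : MvPolynomial (Fin 2) ℝ) (i : ℕ) :
    etaCoeff m (MvPolynomial.pderiv 0 p) i = ((i : ℝ) + 1) • etaCoeff m p (i + 1) := by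
  simp only [etaCoeff, Finset.smul_sum, Polynomial.smul_monomial]
  refine Finset.sum_congr rfl fun k _ => ?_
  rw [MvPolynomial.coeff_pderiv, Finsupp.single_add, add_right_comm]
  simp [mul_comm]

theorem etaCoeff_pderiv_one {m : ℕ} {p : MvPolynomial (Fin 2) ℝ}
    (hp : p ∈ MvPolynomial.restrictDegree (Fin 2) ℝ m) (i : ℕ) :
    etaCoeff m (MvPolynomial.pderiv 1 p) i = (etaCoeff m p i).derivative := by
  ext k
  simp only [etaCoeff, Polynomial.finsetSum_coeff, Polynomial.coeff_derivative,
    Polynomial.coeff_monomial, Finset.sum_ite_eq', Finset.mem_range]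
  rw [MvPolynomial.coeff_pderiv, add_assoc, ← Finsupp.single_add]
  by_cases hk : k + 1 < m + 1
  · rw [if_pos hk, if_pos (by omega)]; simp
  · rw [if_neg hk, MvPolynomial.notMem_support_iff.1 (fun hs => ?_)]
    · simp
    · have := (MvPolynomial.mem_restrictDegree _ _ _).1 hp _ hs 1
      simp at this
      omega

theorem etaCoeff_smul (m : ℕ) (c : ℝ) (p : MvPolynomial (Fin 2) ℝ) (i : ℕ) :
    etaCoeff m (c • p) i = c • etaCoeff m p i := by
  simp [etaCoeff, Finset.smul_sum, Polynomial.smul_monomial]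

theorem etaCoeff_sub (m : ℕ) (p q : MvPolynomial (Fin 2) ℝ) (i : ℕ) :
    etaCoeff m (p - q) i = etaCoeff m p i - etaCoeff m q i := by
  simp [etaCoeff, ← Finset.sum_sub_distrib]

theorem polyFun_smul (c : ℝ) (p : MvPolynomial (Fin 2) ℝ) (η ξ : ℝ) :
    polyFun (c • p) η ξ = c * polyFun p η ξ := by
  simp [polyFun]

theorem polyFun_sub (p q : MvPolynomial (Fin 2) ℝ) (η ξ : ℝ) :
    polyFun (p - q) η ξ = polyFun p η ξ - polyFun q η ξ := by
  simp [polyFun]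

/-! ### Jets at `η = 0` with periodic, hence uniformly bounded, coefficients. -/

theorem exists_abs_le_of_periodic {f : ℝ → ℝ} (hf : Continuous f) {L : ℝ} (hL : 0 < L)
    (hp : Function.Periodic f L) : ∃ M, ∀ x, |f x| ≤ M := by
  obtain ⟨M, hM⟩ := (isCompact_Icc (a := (0 : ℝ)) (b := L)).exists_bound_of_continuousOn
    hf.continuousOn
  refine ⟨M, fun x => ?_⟩
  obtain ⟨y, hy, hxy⟩ := hp.exists_mem_Ico₀ hL x
  rw [hxy]
  exact hM y (Ico_subset_Icc_self hy)

theorem iteratedDeriv_polynomial_eval_zero (p : Polynomial ℝ) (n : ℕ) :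
    iteratedDeriv n (fun x => p.eval x) 0 = n.factorial * p.coeff n := by
  have : iteratedDeriv n (fun x => p.eval x) = fun x => (Polynomial.derivative^[n] p).eval x := by
    induction n with
    | zero => simp
    | succ n ih =>
      rw [iteratedDeriv_succ, ih, Function.iterate_succ_apply']
      funext x
      rw [Polynomial.deriv]
  rw [this]
  simp only
  rw [← Polynomial.coeff_zero_eq_eval_zero, Polynomial.coeff_iterate_derivative]
  simp [Nat.descFactorial_self]

/-- A family of functions of `η`, smooth at `η = 0`, all of whose derivatives at `0` are continuous
`L`-periodic functions of the parameter. -/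
structure IsPeriodicJet (L : ℝ) (f : ℝ → ℝ → ℝ) : Prop where
  contDiffAt : ∀ ξ, ContDiffAt ℝ (⊤ : ℕ∞) (f ξ) 0
  continuous : ∀ n, Continuous fun ξ => iteratedDeriv n (f ξ) 0
  periodic : Function.Periodic f L

namespace IsPeriodicJet

variable {L : ℝ} {f f' : ℝ → ℝ → ℝ}

theorem contDiffAt_nat (hf : IsPeriodicJet L f) (n : ℕ) (ξ : ℝ) : ContDiffAt ℝ n (f ξ) 0 :=
  (hf.contDiffAt ξ).of_le (by exact_mod_cast le_top)

theorem add (hf : IsPeriodicJet L f) (hf' : IsPeriodicJet L f') :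
    IsPeriodicJet L fun ξ η => f ξ η + f' ξ η where
  contDiffAt ξ := (hf.contDiffAt ξ).add (hf'.contDiffAt ξ)
  continuous n := by
    have h : ∀ ξ, iteratedDeriv n (fun η => f ξ η + f' ξ η) 0 =
        iteratedDeriv n (f ξ) 0 + iteratedDeriv n (f' ξ) 0 := fun ξ =>
      iteratedDeriv_add (hf.contDiffAt_nat n ξ) (hf'.contDiffAt_nat n ξ)
    simp only [h]
    exact (hf.continuous n).add (hf'.continuous n)
  periodic ξ := by simp only [hf.periodic ξ, hf'.periodic ξ]

theorem mul (hf : IsPeriodicJet L f) (hf' : IsPeriodicJet L f') :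
    IsPeriodicJet L fun ξ η => f ξ η * f' ξ η where
  contDiffAt ξ := (hf.contDiffAt ξ).mul (hf'.contDiffAt ξ)
  continuous n := by
    have h : ∀ ξ, iteratedDeriv n (fun η => f ξ η * f' ξ η) 0 = ∑ i ∈ Finset.range (n + 1),
        n.choose i * iteratedDeriv i (f ξ) 0 * iteratedDeriv (n - i) (f' ξ) 0 := fun ξ =>
      iteratedDeriv_mul (hf.contDiffAt_nat n ξ) (hf'.contDiffAt_nat n ξ)
    simp only [h]
    have h1 := hf.continuous
    have h2 := hf'.continuous
    exact continuous_finsetSum _ fun i _ => (continuous_const.mul (h1 i)).mul (h2 (n - i))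
  periodic ξ := by simp only [hf.periodic ξ, hf'.periodic ξ]

theorem const {a : ℝ → ℝ} (ha : Continuous a) (hp : Function.Periodic a L) :
    IsPeriodicJet L fun ξ _ => a ξ where
  contDiffAt _ := contDiffAt_const
  continuous n := by
    simp only [iteratedDeriv_const]
    split_ifs
    · exact ha
    · exact continuous_const
  periodic ξ := by simp only [hp ξ]

theorem id : IsPeriodicJet L fun _ η => η where
  contDiffAt _ := contDiffAt_id
  continuous _ := continuous_const
  periodic _ := rfl

/-- The `n`-th derivative at `0` is explicitly `(-1)ⁿ n! kⁿ`, so continuity in `ξ` needs only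
continuity of `k`. -/
theorem inv_one_add_mul {k : ℝ → ℝ} (hk : Continuous k) (hp : Function.Periodic k L) :
    IsPeriodicJet L fun ξ η => (1 + η * k ξ)⁻¹ where
  contDiffAt ξ := by
    refine ContDiffAt.inv (by fun_prop) (by simp)
  continuous n := by
    have h : ∀ ξ, iteratedDeriv n (fun η => (1 + η * k ξ)⁻¹) 0 =
        (-1) ^ n * n.factorial * k ξ ^ n := fun ξ => by
      have h2 := congrFun (iter_deriv_inv_linear n (k ξ) (1 : ℝ)) 0
      rw [iteratedDeriv_eq_iterate]
      simpa [add_comm, mul_comm] using h2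
    simp only [h]
    fun_prop
  periodic ξ := by simp only [hp ξ]

theorem iteratedDeriv_eval_mul (hf : IsPeriodicJet L f) (p : Polynomial ℝ) (j : ℕ) (ξ : ℝ) :
    iteratedDeriv j (fun η => p.eval η * f ξ η) 0 = ∑ i ∈ Finset.range (j + 1),
      (j.choose i * i.factorial * iteratedDeriv (j - i) (f ξ) 0) * p.coeff i := by
  have h : iteratedDeriv j (fun η => p.eval η * f ξ η) 0 = ∑ i ∈ Finset.range (j + 1),
      j.choose i * iteratedDeriv i (fun η => p.eval η) 0 * iteratedDeriv (j - i) (f ξ) 0 :=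
    iteratedDeriv_mul (Polynomial.contDiff_aeval p _).contDiffAt (hf.contDiffAt_nat j ξ)
  rw [h]
  refine Finset.sum_congr rfl fun i _ => ?_
  rw [iteratedDeriv_polynomial_eval_zero]
  ring

end IsPeriodicJet

/-! ### The Laplacian in Frenet coordinates and its normal derivatives on the interface. -/

section Frenet

variable {g : ℝ → Plane}

theorem contDiff_speed {n : ℕ} (hg : ContDiff ℝ (n + 1) g) (hreg : ∀ ξ, deriv g ξ ≠ 0) :
    ContDiff ℝ n fun ξ => ‖deriv g ξ‖ :=
  (hg.deriv' (n := n)).norm ℝ hreg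

theorem contDiff_signedCurvature {n : ℕ} (hg : ContDiff ℝ (n + 2) g) (hreg : ∀ ξ, deriv g ξ ≠ 0) :
    ContDiff ℝ n (signedCurvature g) := by
  have h1 : ContDiff ℝ (n + 1) (deriv g) :=
    ContDiff.deriv' (by rw [add_assoc, one_add_one_eq_two]; exact hg)
  have h2 : ContDiff ℝ n (deriv (deriv g)) := h1.deriv'
  have h1' := contDiff_euclidean.1 (h1.of_le (m := n) le_self_add)
  have h2' := contDiff_euclidean.1 h2
  have h3 := (h1.of_le (m := n) le_self_add).norm ℝ hreg
  unfold signedCurvature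
  exact (((h1' 0).mul (h2' 1)).sub ((h1' 1).mul (h2' 0))).div (h3.pow 3)
    fun ξ => pow_ne_zero _ (norm_ne_zero_iff.2 (hreg ξ))

theorem periodic_deriv {E : Type*} [NormedAddCommGroup E] [NormedSpace ℝ E] {f : ℝ → E} {L : ℝ}
    (h : Function.Periodic f L) : Function.Periodic (deriv f) L := fun x => by
  rw [← deriv_comp_add_const]
  exact congrArg (deriv · x) (funext h)

theorem periodic_signedCurvature {L : ℝ} (h : Function.Periodic g L) :
    Function.Periodic (signedCurvature g) L := fun x => by
  simp only [signedCurvature, periodic_deriv h x, periodic_deriv (periodic_deriv h) x]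

/-- The Laplacian in Frenet coordinates in nondivergence form. -/
theorem frenetLaplacian_polyFun (hs : Differentiable ℝ fun ξ => ‖deriv g ξ‖)
    (hk : Differentiable ℝ (signedCurvature g)) (hreg : ∀ ξ, deriv g ξ ≠ 0)
    (p : MvPolynomial (Fin 2) ℝ) {η ξ : ℝ} (hη : 1 + η * signedCurvature g ξ ≠ 0) :
    frenetLaplacian g (polyFun p) η ξ =
      polyFun (MvPolynomial.pderiv 0 (MvPolynomial.pderiv 0 p)) η ξ +
      polyFun (MvPolynomial.pderiv 0 p) η ξ *
        (signedCurvature g ξ * (1 + η * signedCurvature g ξ)⁻¹) +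
      polyFun (MvPolynomial.pderiv 1 (MvPolynomial.pderiv 1 p)) η ξ *
        ((‖deriv g ξ‖ ^ 2)⁻¹ *
          ((1 + η * signedCurvature g ξ)⁻¹ * (1 + η * signedCurvature g ξ)⁻¹)) +
      polyFun (MvPolynomial.pderiv 1 p) η ξ *
        (-(‖deriv g ξ‖ ^ 3)⁻¹ *
          ((1 + η * signedCurvature g ξ)⁻¹ * ((1 + η * signedCurvature g ξ)⁻¹ *
            (1 + η * signedCurvature g ξ)⁻¹)) *
          (deriv (fun s => ‖deriv g s‖) ξ +
            η * deriv (fun s => ‖deriv g s‖ * signedCurvature g s) ξ)) := by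
  have hpos : ‖deriv g ξ‖ ≠ 0 := norm_ne_zero_iff.2 (hreg ξ)
  have hJ : frenetJacobian g η ξ ≠ 0 := mul_ne_zero hpos hη
  have hJη : HasDerivAt (fun s => frenetJacobian g s ξ) (‖deriv g ξ‖ * signedCurvature g ξ) η := by
    simpa [frenetJacobian] using
      (((hasDerivAt_id η).mul_const (signedCurvature g ξ)).const_add 1).const_mul ‖deriv g ξ‖
  have hJξ : HasDerivAt (fun s => frenetJacobian g η s) (deriv (fun s => ‖deriv g s‖) ξ +
      η * deriv (fun s => ‖deriv g s‖ * signedCurvature g s) ξ) ξ := by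
    have h := (hs ξ).hasDerivAt.fun_add (((hs.fun_mul hk) ξ).hasDerivAt.const_mul η)
    refine h.congr_of_eventuallyEq (.of_forall fun s => ?_)
    simp only [frenetJacobian]; ring
  have hu : (fun s => frenetJacobian g s ξ * deriv (fun r => polyFun p r ξ) s) =
      fun s => frenetJacobian g s ξ * polyFun (MvPolynomial.pderiv 0 p) s ξ :=
    funext fun s => by rw [(hasDerivAt_polyFun_zero p s ξ).deriv]
  have hv : (fun s => (frenetJacobian g η s)⁻¹ * deriv (fun r => polyFun p η r) s) =
      fun s => (frenetJacobian g η s)⁻¹ * polyFun (MvPolynomial.pderiv 1 p) η s :=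
    funext fun s => by rw [(hasDerivAt_polyFun_one p η s).deriv]
  rw [frenetLaplacian, hu, hv, (hJη.fun_mul (hasDerivAt_polyFun_zero _ η ξ)).deriv,
    ((hJξ.fun_inv hJ).fun_mul (hasDerivAt_polyFun_one _ η ξ)).deriv]
  simp only [frenetJacobian]
  field_simp
  ring

/-- The `η`-derivatives on the interface of the Laplacian in Frenet coordinates. -/
theorem exists_iteratedDeriv_frenetLaplacian (m : ℕ) {L : ℝ} (hL : 0 < L)
    (hper : Function.Periodic g L) (hg : ContDiff ℝ 3 g) (hreg : ∀ ξ, deriv g ξ ≠ 0) :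
    ∃ (A B D : ℕ → ℕ → ℝ → ℝ) (M : ℝ), 0 < M ∧ (∀ j i, Continuous (A j i)) ∧
      (∀ j i, Continuous (B j i)) ∧ (∀ j i, Continuous (D j i)) ∧
      (∀ j < m, ∀ i ≤ j, ∀ ξ, |A j i ξ| ≤ M ∧ |B j i ξ| ≤ M ∧ |D j i ξ| ≤ M) ∧
      ∀ p ∈ MvPolynomial.restrictDegree (Fin 2) ℝ m, ∀ j ξ,
        iteratedDeriv j (fun η => frenetLaplacian g (polyFun p) η ξ) 0 =
          ((j + 2).factorial : ℝ) * (etaCoeff m p (j + 2)).eval ξ +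
          ∑ i ∈ Finset.range (j + 1), (A j i ξ * (etaCoeff m p (i + 1)).eval ξ +
            B j i ξ * (etaCoeff m p i).derivative.derivative.eval ξ +
            D j i ξ * (etaCoeff m p i).derivative.eval ξ) := by
  set k := signedCurvature g with hk
  set s := fun ξ => ‖deriv g ξ‖ with hs
  have hs1 : ContDiff ℝ 1 s := by
    have := contDiff_speed (n := 2) (g := g) (by exact_mod_cast hg) hreg
    exact this.of_le (by norm_num)
  have hk1 : ContDiff ℝ 1 k := contDiff_signedCurvature (n := 1) (by exact_mod_cast hg) hreg
  have hsk1 : ContDiff ℝ 1 fun ξ => s ξ * k ξ := hs1.mul hk1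
  have hsp : Function.Periodic s L := fun ξ => by simp only [hs, periodic_deriv hper ξ]
  have hkp : Function.Periodic k L := periodic_signedCurvature hper
  have hskp : Function.Periodic (fun ξ => s ξ * k ξ) L := fun ξ => by simp only [hsp ξ, hkp ξ]
  have hs0 : ∀ ξ, s ξ ≠ 0 := fun ξ => norm_ne_zero_iff.2 (hreg ξ)
  have hsc := hs1.continuous
  have hkc := hk1.continuous
  have hw := IsPeriodicJet.inv_one_add_mul hkc hkp
  have hA := (IsPeriodicJet.const hkc hkp).mul hw
  have hB := (IsPeriodicJet.const (a := fun ξ => (s ξ ^ 2)⁻¹) (L := L)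
    ((hsc.pow 2).inv₀ fun ξ => pow_ne_zero _ (hs0 ξ)) fun ξ => by simp only [hsp ξ]).mul
      (hw.mul hw)
  have hD := ((IsPeriodicJet.const (a := fun ξ => -(s ξ ^ 3)⁻¹) (L := L)
    ((hsc.pow 3).inv₀ fun ξ => pow_ne_zero _ (hs0 ξ)).neg fun ξ => by simp only [hsp ξ]).mul
      (hw.mul (hw.mul hw))).mul
      ((IsPeriodicJet.const (hs1.continuous_deriv le_rfl) (periodic_deriv hsp)).add
        (IsPeriodicJet.id.mul
          (IsPeriodicJet.const (hsk1.continuous_deriv le_rfl) (periodic_deriv hskp))))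
  generalize hAf : (fun ξ η => k ξ * (1 + η * k ξ)⁻¹) = fA at hA
  generalize hBf : (fun ξ η => (s ξ ^ 2)⁻¹ * ((1 + η * k ξ)⁻¹ * (1 + η * k ξ)⁻¹)) = fB at hB
  generalize hDf : (fun ξ η => -(s ξ ^ 3)⁻¹ *
    ((1 + η * k ξ)⁻¹ * ((1 + η * k ξ)⁻¹ * (1 + η * k ξ)⁻¹)) *
    (deriv s ξ + η * deriv (fun ξ => s ξ * k ξ) ξ)) = fD at hD
  -- These are the Leibniz coefficients of the products of polynomials in `η` with the jets. The
  -- extra factor `i + 1` in `A` comes from differentiating `η ^ (i + 1)`.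
  let A : ℕ → ℕ → ℝ → ℝ := fun j i ξ =>
    (j.choose i * i.factorial * iteratedDeriv (j - i) (fA ξ) 0) * (i + 1)
  let B : ℕ → ℕ → ℝ → ℝ := fun j i ξ =>
    j.choose i * i.factorial * iteratedDeriv (j - i) (fB ξ) 0
  let D : ℕ → ℕ → ℝ → ℝ := fun j i ξ =>
    j.choose i * i.factorial * iteratedDeriv (j - i) (fD ξ) 0
  have hAc : ∀ j i, Continuous (A j i) := fun j i =>
    (continuous_const.mul (hA.continuous _)).mul continuous_const
  have hBc : ∀ j i, Continuous (B j i) := fun j i => continuous_const.mul (hB.continuous _)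
  have hDc : ∀ j i, Continuous (D j i) := fun j i => continuous_const.mul (hD.continuous _)
  have hAp : ∀ j i, Function.Periodic (A j i) L := fun j i ξ => by simp only [A, hA.periodic ξ]
  have hBp : ∀ j i, Function.Periodic (B j i) L := fun j i ξ => by simp only [B, hB.periodic ξ]
  have hDp : ∀ j i, Function.Periodic (D j i) L := fun j i ξ => by simp only [D, hD.periodic ξ]
  choose MA hMA using fun j i => exists_abs_le_of_periodic (hAc j i) hL (hAp j i)
  choose MB hMB using fun j i => exists_abs_le_of_periodic (hBc j i) hL (hBp j i)
  choose MD hMD using fun j i => exists_abs_le_of_periodic (hDc j i) hL (hDp j i)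
  have hA0 : ∀ j i, 0 ≤ MA j i := fun j i => (abs_nonneg _).trans (hMA j i 0)
  have hB0 : ∀ j i, 0 ≤ MB j i := fun j i => (abs_nonneg _).trans (hMB j i 0)
  have hD0 : ∀ j i, 0 ≤ MD j i := fun j i => (abs_nonneg _).trans (hMD j i 0)
  have hsum0 : ∀ j i, 0 ≤ MA j i + MB j i + MD j i := fun j i => by
    linarith [hA0 j i, hB0 j i, hD0 j i]
  have hbound : ∀ j < m, ∀ i ≤ j, MA j i + MB j i + MD j i ≤
      1 + ∑ j ∈ Finset.range m, ∑ i ∈ Finset.range m, (MA j i + MB j i + MD j i) := by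
    intro j hj i hi
    have h1 := Finset.single_le_sum (f := fun i => MA j i + MB j i + MD j i)
      (fun i _ => hsum0 j i) (Finset.mem_range.2 (hi.trans_lt hj))
    have h2 := Finset.single_le_sum
      (f := fun j => ∑ i ∈ Finset.range m, (MA j i + MB j i + MD j i))
      (fun j _ => Finset.sum_nonneg fun i _ => hsum0 j i) (Finset.mem_range.2 hj)
    linarith
  refine ⟨A, B, D, 1 + ∑ j ∈ Finset.range m, ∑ i ∈ Finset.range m, (MA j i + MB j i + MD j i),
    ?_, hAc, hBc, hDc, ?_, ?_⟩
  · have : 0 ≤ ∑ j ∈ Finset.range m, ∑ i ∈ Finset.range m, (MA j i + MB j i + MD j i) :=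
      Finset.sum_nonneg fun j _ => Finset.sum_nonneg fun i _ => hsum0 j i
    linarith
  · intro j hj i hi ξ
    have := hbound j hj i hi
    refine ⟨?_, ?_, ?_⟩ <;>
      linarith [hMA j i ξ, hMB j i ξ, hMD j i ξ, hA0 j i, hB0 j i, hD0 j i]
  · intro p hp j ξ
    have p0 := pderiv_mem_restrictDegree hp 0
    have p1 := pderiv_mem_restrictDegree hp 1
    have p00 := pderiv_mem_restrictDegree p0 0
    have p11 := pderiv_mem_restrictDegree p1 1
    -- The nondivergence form requires `1 + η κ ≠ 0`. This holds near `η = 0`, which suffices for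
    -- derivatives at `0`.
    have hev : (fun η => frenetLaplacian g (polyFun p) η ξ) =ᶠ[nhds 0] fun η =>
        (((etaPoly m (MvPolynomial.pderiv 0 (MvPolynomial.pderiv 0 p)) ξ).eval η +
        (etaPoly m (MvPolynomial.pderiv 0 p) ξ).eval η * fA ξ η) +
        (etaPoly m (MvPolynomial.pderiv 1 (MvPolynomial.pderiv 1 p)) ξ).eval η * fB ξ η) +
        (etaPoly m (MvPolynomial.pderiv 1 p) ξ).eval η * fD ξ η := by
      have hc : ContinuousAt (fun η => 1 + η * k ξ) 0 := by fun_prop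
      filter_upwards [hc.eventually_ne (by simp : 1 + 0 * k ξ ≠ 0)] with η hη
      rw [frenetLaplacian_polyFun (hs1.differentiable (by norm_num))
        (hk1.differentiable (by norm_num)) hreg p hη, eval_etaPoly p00, eval_etaPoly p0,
        eval_etaPoly p11, eval_etaPoly p1, ← hAf, ← hBf, ← hDf]
    have cpoly : ∀ q : Polynomial ℝ, ContDiffAt ℝ j (fun η => q.eval η) 0 := fun q =>
      (Polynomial.contDiff_aeval q _).contDiffAt
    rw [hev.iteratedDeriv_eq, iteratedDeriv_fun_add
      (((cpoly _).add ((cpoly _).mul (hA.contDiffAt_nat j ξ))).add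
        ((cpoly _).mul (hB.contDiffAt_nat j ξ))) ((cpoly _).mul (hD.contDiffAt_nat j ξ)),
      iteratedDeriv_fun_add
      ((cpoly _).add ((cpoly _).mul (hA.contDiffAt_nat j ξ))) ((cpoly _).mul (hB.contDiffAt_nat j ξ)),
      iteratedDeriv_fun_add (cpoly _) ((cpoly _).mul (hA.contDiffAt_nat j ξ)),
      iteratedDeriv_polynomial_eval_zero, hA.iteratedDeriv_eval_mul, hB.iteratedDeriv_eval_mul,
      hD.iteratedDeriv_eval_mul, coeff_etaPoly p00, Finset.sum_add_distrib, Finset.sum_add_distrib]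
    have e1 : ((j.factorial : ℕ) : ℝ) *
        (etaCoeff m (MvPolynomial.pderiv 0 (MvPolynomial.pderiv 0 p)) j).eval ξ =
        ((j + 2).factorial : ℝ) * (etaCoeff m p (j + 2)).eval ξ := by
      rw [etaCoeff_pderiv_zero, etaCoeff_pderiv_zero]
      simp only [Polynomial.eval_smul, smul_eq_mul, Nat.factorial_succ]
      push_cast
      ring
    rw [e1]
    simp only [add_assoc]
    congr 1
    congr 1
    · refine Finset.sum_congr rfl fun i _ => ?_
      rw [coeff_etaPoly p0, etaCoeff_pderiv_zero]
      simp only [A, Polynomial.eval_smul, smul_eq_mul]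
      ring
    congr 1
    · refine Finset.sum_congr rfl fun i _ => ?_
      rw [coeff_etaPoly p11, etaCoeff_pderiv_one p1, etaCoeff_pderiv_one hp]
    · refine Finset.sum_congr rfl fun i _ => ?_
      rw [coeff_etaPoly p1, etaCoeff_pderiv_one hp]

end Frenet

/-! ### The recursion for the coefficients of `β⁺φ⁺ - β⁻φ⁻`. -/

/-- The inverse estimate in the scaling of the recursion: on an interval of length at least `κ h`, a
tangential derivative costs one power of `h`. -/
theorem exists_pow_mul_derivative_le (m : ℕ) {κ : ℝ} (hκ : 0 < κ) : ∃ C > 0,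
    ∀ p : Polynomial ℝ, p.natDegree ≤ m → ∀ h a b X : ℝ, 0 < h → κ * h ≤ b - a → ∀ k : ℕ,
      (∀ t ∈ Icc a b, h ^ k * |p.eval t| ≤ X) →
      ∀ t ∈ Icc a b, h ^ (k + 1) * |p.derivative.eval t| ≤ C * X := by
  obtain ⟨C, hC, H⟩ := exists_derivative_le m
  refine ⟨C / κ, by positivity, fun p hp h a b X hh hab k hX t ht => ?_⟩
  have hX0 : 0 ≤ X := le_trans (by positivity) (hX t ht)
  have hlt : a < b := by have := mul_pos hκ hh; linarith
  have hpk : 0 < h ^ k := by positivity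
  have h1 := H p hp a b (X / h ^ k) hlt
    (fun s hs => by rw [le_div_iff₀' hpk]; exact hX s hs) t ht
  have h2 : C / (b - a) ≤ C / (κ * h) := by gcongr
  calc h ^ (k + 1) * |p.derivative.eval t| ≤ h ^ (k + 1) * (C / (κ * h) * (X / h ^ k)) := by
        gcongr
        exact h1.trans (by gcongr)
    _ = C / κ * X := by field_simp; ring

/-- The coefficients of a piecewise polynomial extension across the interface are controlled by the
tangential derivative of the trace, when they are defined recursively by projecting a second order
operator in the tangential variable. -/
theorem exists_coeff_recursion_bound (m : ℕ) {A B D : ℕ → ℕ → ℝ → ℝ} {M κ : ℝ} (hM : 0 < M)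
    (hκ : 0 < κ) (hA : ∀ j i, Continuous (A j i)) (hB : ∀ j i, Continuous (B j i))
    (hD : ∀ j i, Continuous (D j i))
    (hbd : ∀ j < m, ∀ i ≤ j, ∀ ξ, |A j i ξ| ≤ M ∧ |B j i ξ| ≤ M ∧ |D j i ξ| ≤ M) (n : ℕ) :
    ∃ C > 0, ∀ h a b : ℝ, 0 < h → h ≤ 1 → κ * h ≤ b - a → ∀ q : ℕ → Polynomial ℝ,
      (∀ i, (q i).natDegree ≤ m) → (∀ t ∈ Icc a b, (q 1).eval t = 0) →
      (∀ j, j + 2 ≤ m → ∫ t in a..b, (((j + 2).factorial : ℝ) * (q (j + 2)).eval t +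
          ∑ i ∈ Finset.range (j + 1), (A j i t * (q (i + 1)).eval t +
            B j i t * (q i).derivative.derivative.eval t +
            D j i t * (q i).derivative.eval t)) * (q (j + 2)).eval t = 0) →
      ∀ X : ℝ, (∀ t ∈ Icc a b, |(q 0).derivative.eval t| ≤ X) →
      ∀ i < n, i < m → ∀ t ∈ Icc a b, h ^ i * |(q (i + 1)).eval t| ≤ C * X := by
  induction n with
  | zero => exact ⟨1, one_pos, by intros; omega⟩
  | succ n ih =>
    obtain ⟨C, hC, ih⟩ := ih
    obtain ⟨c, hc, hder⟩ := exists_pow_mul_derivative_le m hκ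
    obtain ⟨Cp, hCp, hproj⟩ := exists_abs_le_of_integral_add_mul_eq_zero m
    -- `E` bounds the scaled first derivatives: the `1` is for `q₀'`, which is bounded by
    -- assumption, and `c * C` is for the later coefficients, by the inverse estimate. `K` adds up
    -- the `n` lower-order terms.
    set E := 1 + c * C with hE
    set K := n * (M * C + M * (c * E) + M * E) with hK
    have hE0 : 0 < E := by positivity
    have hK0 : 0 ≤ K := by positivity
    refine ⟨C + Cp * K, by positivity, fun h a b hh hh1 hab q hdeg hq1 hint X hX i hi him t ht => ?_⟩
    have hX0 : 0 ≤ X := (abs_nonneg _).trans (hX t ht)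
    have hlt : a < b := by have := mul_pos hκ hh; linarith
    have ih' := ih h a b hh hh1 hab q hdeg hq1 hint X hX
    rcases Nat.lt_succ_iff_lt_or_eq.1 hi with hin | rfl
    · refine (ih' i hin him t ht).trans ?_
      gcongr
      have : 0 ≤ Cp * K := by positivity
      linarith
    rcases Nat.eq_zero_or_pos i with rfl | hipos
    · rw [zero_add, hq1 t ht]; simp; positivity
    obtain ⟨j, rfl⟩ : ∃ j, i = j + 1 := ⟨i - 1, by omega⟩
    have hd1 : ∀ l ≤ j, ∀ s ∈ Icc a b, h ^ l * |(q l).derivative.eval s| ≤ E * X := by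
      intro l hl s hs
      rcases Nat.eq_zero_or_pos l with rfl | hlpos
      · rw [pow_zero, one_mul]
        refine (hX s hs).trans (le_mul_of_one_le_left hX0 ?_)
        have : 0 ≤ c * C := by positivity
        linarith
      · obtain ⟨l, rfl⟩ : ∃ k, l = k + 1 := ⟨l - 1, by omega⟩
        refine (hder _ (hdeg _) h a b (C * X) hh hab l (ih' l (by omega) (by omega)) s hs).trans ?_
        rw [hE]; nlinarith
    have hd2 : ∀ l ≤ j, ∀ s ∈ Icc a b,
        h ^ (l + 1) * |(q l).derivative.derivative.eval s| ≤ c * (E * X) := fun l hl =>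
      hder _ ((q l).natDegree_derivative_le.trans ((Nat.sub_le _ _).trans (hdeg l))) h a b (E * X)
        hh hab l (hd1 l hl)
    -- The natural weights of `q_{l+1}`, `q_l''` and `q_l'` are `h ^ l`, `h ^ (l + 1)` and `h ^ l`.
    -- As `l ≤ j` and `h ≤ 1`, the common weight `h ^ (j + 1)` is no larger.
    have hterm : ∀ l ≤ j, ∀ s ∈ Icc a b, h ^ (j + 1) * |A j l s * (q (l + 1)).eval s +
        B j l s * (q l).derivative.derivative.eval s + D j l s * (q l).derivative.eval s| ≤
          (M * C + M * (c * E) + M * E) * X := by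
      intro l hl s hs
      obtain ⟨b1, b2, b3⟩ := hbd j (by omega) l hl s
      have e1 : h ^ (j + 1) * |(q (l + 1)).eval s| ≤ C * X := by
        refine le_trans ?_ (ih' l (by omega) (by omega) s hs)
        gcongr ?_ * _
        exact pow_le_pow_of_le_one hh.le hh1 (by omega)
      have e2 : h ^ (j + 1) * |(q l).derivative.derivative.eval s| ≤ c * (E * X) := by
        refine le_trans ?_ (hd2 l hl s hs)
        gcongr ?_ * _
        exact pow_le_pow_of_le_one hh.le hh1 (by omega)
      have e3 : h ^ (j + 1) * |(q l).derivative.eval s| ≤ E * X := by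
        refine le_trans ?_ (hd1 l hl s hs)
        gcongr ?_ * _
        exact pow_le_pow_of_le_one hh.le hh1 (by omega)
      have hpk : 0 ≤ h ^ (j + 1) := by positivity
      calc _ ≤ h ^ (j + 1) * (|A j l s| * |(q (l + 1)).eval s| +
            |B j l s| * |(q l).derivative.derivative.eval s| +
            |D j l s| * |(q l).derivative.eval s|) := by
            gcongr
            simp only [← abs_mul]
            exact abs_add_three _ _ _
        _ = |A j l s| * (h ^ (j + 1) * |(q (l + 1)).eval s|) +
            |B j l s| * (h ^ (j + 1) * |(q l).derivative.derivative.eval s|) +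
            |D j l s| * (h ^ (j + 1) * |(q l).derivative.eval s|) := by ring
        _ ≤ M * (C * X) + M * (c * (E * X)) + M * (E * X) := by gcongr
        _ = _ := by ring
    have hpk : 0 < h ^ (j + 1) := by positivity
    have hR : ∀ s ∈ Icc a b, |∑ l ∈ Finset.range (j + 1), (A j l s * (q (l + 1)).eval s +
        B j l s * (q l).derivative.derivative.eval s + D j l s * (q l).derivative.eval s)| ≤
          K * X / h ^ (j + 1) := by
      intro s hs
      refine (Finset.abs_sum_le_sum_abs _ _).trans ?_
      rw [le_div_iff₀' hpk, Finset.mul_sum]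
      refine (Finset.sum_le_sum fun l hl =>
        hterm l (Nat.lt_succ_iff.1 (Finset.mem_range.1 hl)) s hs).trans ?_
      rw [Finset.sum_const, Finset.card_range, nsmul_eq_mul, hK, mul_assoc]
    -- The factorial is the number `k ≥ 1` of the projection estimate, and the lower-order sum is
    -- its bounded function `R`.
    have h1 := hproj (q (j + 2)) (hdeg _) a b _ ((j + 2).factorial : ℝ) _ hlt
      (by exact_mod_cast Nat.succ_le_of_lt (Nat.factorial_pos _)) (by
        refine continuous_finsetSum _ fun l _ => ?_
        have := hA j l
        have := hB j l
        have := hD j l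
        fun_prop) hR (hint j (by omega)) t ht
    calc h ^ (j + 1) * |(q (j + 1 + 1)).eval t| ≤ h ^ (j + 1) * (Cp * (K * X / h ^ (j + 1))) := by
          gcongr
      _ = Cp * K * X := by field_simp
      _ ≤ (C + Cp * K) * X := by nlinarith

/-- The weight `h ^ i` on the coefficient of `η ^ (i + 1)` is what `∂_η` needs when `|η| ≤ h`. For
`∂_ξ` the extra power of `η` pays for the inverse estimate. -/
theorem exists_gradient_le_of_coeff_le (m : ℕ) {κ : ℝ} (hκ : 0 < κ) (c : ℝ) : ∃ C > 0,
    ∀ q ∈ MvPolynomial.restrictDegree (Fin 2) ℝ m, ∀ h a b : ℝ, 0 < h → κ * h ≤ b - a → ∀ X : ℝ,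
      (∀ t ∈ Icc a b, |(etaCoeff m q 0).derivative.eval t| ≤ X) →
      (∀ i < m, ∀ t ∈ Icc a b, h ^ i * |(etaCoeff m q (i + 1)).eval t| ≤ c * X) →
      ∀ η, |η| ≤ h → ∀ ξ ∈ Icc a b,
        |polyFun (MvPolynomial.pderiv 0 q) η ξ| ≤ C * X ∧
        |polyFun (MvPolynomial.pderiv 1 q) η ξ| ≤ C * X := by
  obtain ⟨d, hd, hder⟩ := exists_pow_mul_derivative_le m hκ
  refine ⟨(m + 1) * ((m + 1) * |c|) + (m + 1) * (1 + d * |c|), by positivity,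
    fun q hq h a b hh hab X hX hc η hη ξ hξ => ?_⟩
  have hX0 : 0 ≤ X := (abs_nonneg _).trans (hX ξ hξ)
  have hc' : ∀ i, ∀ t ∈ Icc a b, h ^ i * |(etaCoeff m q (i + 1)).eval t| ≤ |c| * X := by
    intro i t ht
    by_cases hi : i < m
    · exact (hc i hi t ht).trans (by gcongr; exact le_abs_self c)
    · rw [etaCoeff_eq_zero hq (by omega)]; simp; positivity
  have h0 : |polyFun (MvPolynomial.pderiv 0 q) η ξ| ≤ (m + 1) * ((m + 1) * |c|) * X := by
    rw [polyFun_eq_sum (pderiv_mem_restrictDegree hq 0)]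
    refine (Finset.abs_sum_le_sum_abs _ _).trans ?_
    refine (Finset.sum_le_card_nsmul _ _ ((m + 1) * |c| * X) fun i hi => ?_).trans_eq (by
      rw [Finset.card_range, nsmul_eq_mul]; push_cast; ring)
    rw [etaCoeff_pderiv_zero, Polynomial.eval_smul, smul_eq_mul, abs_mul, abs_mul, abs_pow,
      abs_of_nonneg (by positivity : (0 : ℝ) ≤ (i : ℝ) + 1)]
    have hi' : (i : ℝ) ≤ m := by exact_mod_cast Nat.lt_succ_iff.1 (Finset.mem_range.1 hi)
    calc |η| ^ i * (((i : ℝ) + 1) * |(etaCoeff m q (i + 1)).eval ξ|)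
        ≤ h ^ i * (((m : ℝ) + 1) * |(etaCoeff m q (i + 1)).eval ξ|) := by gcongr
      _ = ((m : ℝ) + 1) * (h ^ i * |(etaCoeff m q (i + 1)).eval ξ|) := by ring
      _ ≤ ((m : ℝ) + 1) * (|c| * X) := mul_le_mul_of_nonneg_left (hc' i ξ hξ) (by positivity)
      _ = _ := by ring
  have h1 : |polyFun (MvPolynomial.pderiv 1 q) η ξ| ≤ (m + 1) * (1 + d * |c|) * X := by
    rw [polyFun_eq_sum (pderiv_mem_restrictDegree hq 1)]
    refine (Finset.abs_sum_le_sum_abs _ _).trans ?_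
    refine (Finset.sum_le_card_nsmul _ _ ((1 + d * |c|) * X) fun i hi => ?_).trans_eq (by
      rw [Finset.card_range, nsmul_eq_mul]; push_cast; ring)
    rw [etaCoeff_pderiv_one hq, abs_mul, abs_pow]
    have hdc : 0 ≤ d * |c| * X := by positivity
    rcases Nat.eq_zero_or_pos i with rfl | hi0
    · rw [pow_zero, one_mul]
      exact (hX ξ hξ).trans (by linarith)
    · obtain ⟨i, rfl⟩ : ∃ k, i = k + 1 := ⟨i - 1, by omega⟩
      calc |η| ^ (i + 1) * |(etaCoeff m q (i + 1)).derivative.eval ξ|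
          ≤ h ^ (i + 1) * |(etaCoeff m q (i + 1)).derivative.eval ξ| := by gcongr
        _ ≤ d * (|c| * X) :=
          hder _ (natDegree_etaCoeff_le _ _ _) h a b _ hh hab i (hc' i) ξ hξ
        _ ≤ _ := by linarith
  have p0 : 0 ≤ (m + 1) * ((m + 1) * |c|) * X := by positivity
  have p1 : 0 ≤ (m + 1) * (1 + d * |c|) * X := by positivity
  constructor <;> linarith

theorem polyFun_zero_left {m : ℕ} {p : MvPolynomial (Fin 2) ℝ}
    (hp : p ∈ MvPolynomial.restrictDegree (Fin 2) ℝ m) (ξ : ℝ) :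
    polyFun p 0 ξ = (etaCoeff m p 0).eval ξ := by
  rw [polyFun_eq_sum hp, Finset.sum_range_succ']
  simp

/-- The gradient of `βp φ⁺ - βm φ⁻`, where `φ` is a Frenet IFE function, is controlled by the
tangential derivative of its trace on the interface. -/
theorem exists_gradient_sub_le {m : ℕ} {g : ℝ → Plane} {L : ℝ} (hL : 0 < L)
    (hper : Function.Periodic g L) (hg : ContDiff ℝ (m + 1) g) (hreg : ∀ ξ, deriv g ξ ≠ 0)
    {κ : ℝ} (hκ : 0 < κ) : ∃ C > 0, ∀ h a b : ℝ, 0 < h → h ≤ 1 → κ * h ≤ b - a →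
      ∀ (βm βp : ℝ) (pm pp : MvPolynomial (Fin 2) ℝ), IsFrenetIFE g m βm βp a b pm pp →
      ∀ X : ℝ, (∀ ξ ∈ Icc a b, |polyFun (MvPolynomial.pderiv 1 (βp • pp - βm • pm)) 0 ξ| ≤ X) →
      ∀ η, |η| ≤ h → ∀ ξ ∈ Icc a b,
        |polyFun (MvPolynomial.pderiv 0 (βp • pp - βm • pm)) η ξ| ≤ C * X ∧
        |polyFun (MvPolynomial.pderiv 1 (βp • pp - βm • pm)) η ξ| ≤ C * X := by
  have hone : ∀ (a b βm βp : ℝ) (pm pp : MvPolynomial (Fin 2) ℝ),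
      IsFrenetIFE g m βm βp a b pm pp →
      ∀ t ∈ Icc a b, (etaCoeff m (βp • pp - βm • pm) 1).eval t = 0 := by
    intro a b βm βp pm pp hφ t ht
    have h1 := hφ.jump_flux t ht
    rw [polyFun_zero_left (pderiv_mem_restrictDegree hφ.mem_plus 0),
      polyFun_zero_left (pderiv_mem_restrictDegree hφ.mem_minus 0), etaCoeff_pderiv_zero,
      etaCoeff_pderiv_zero] at h1
    simpa [etaCoeff_sub, etaCoeff_smul] using h1
  suffices hc : ∃ c, ∀ h a b : ℝ, 0 < h → h ≤ 1 → κ * h ≤ b - a →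
      ∀ (βm βp : ℝ) (pm pp : MvPolynomial (Fin 2) ℝ), IsFrenetIFE g m βm βp a b pm pp →
      ∀ X : ℝ, (∀ t ∈ Icc a b, |(etaCoeff m (βp • pp - βm • pm) 0).derivative.eval t| ≤ X) →
      ∀ i < m, ∀ t ∈ Icc a b,
        h ^ i * |(etaCoeff m (βp • pp - βm • pm) (i + 1)).eval t| ≤ c * X by
    obtain ⟨c, hc⟩ := hc
    obtain ⟨C, hC, H⟩ := exists_gradient_le_of_coeff_le m hκ c
    refine ⟨C, hC, fun h a b hh hh1 hab βm βp pm pp hφ X hX => ?_⟩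
    have hq : βp • pp - βm • pm ∈ MvPolynomial.restrictDegree (Fin 2) ℝ m :=
      sub_mem (Submodule.smul_mem _ _ hφ.mem_plus) (Submodule.smul_mem _ _ hφ.mem_minus)
    have hX' : ∀ t ∈ Icc a b, |(etaCoeff m (βp • pp - βm • pm) 0).derivative.eval t| ≤ X := by
      intro t ht
      rw [← etaCoeff_pderiv_one hq, ← polyFun_zero_left (pderiv_mem_restrictDegree hq 1)]
      exact hX t ht
    exact H _ hq h a b hh hab X hX' (hc h a b hh hh1 hab βm βp pm pp hφ X hX')
  -- Laplacian conditions exist only for `m ≥ 2`, and then `g` is `C³`, as the derivative of the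
  -- Jacobian requires. For `m ≤ 1` only the flux coefficient is left, and it vanishes.
  by_cases hm : 2 ≤ m
  · have hg3 : ContDiff ℝ 3 g := hg.of_le (by
      have : ((3 : ℕ) : WithTop ℕ∞) ≤ ((m + 1 : ℕ) : WithTop ℕ∞) := by
        exact_mod_cast (by omega : 3 ≤ m + 1)
      exact_mod_cast this)
    obtain ⟨A, B, D, M, hM, hA, hB, hD, hbd, hform⟩ :=
      exists_iteratedDeriv_frenetLaplacian m hL hper hg3 hreg
    obtain ⟨c, hc, H⟩ := exists_coeff_recursion_bound m hM hκ hA hB hD hbd m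
    refine ⟨c, fun h a b hh hh1 hab βm βp pm pp hφ X hX i hi => ?_⟩
    refine H h a b hh hh1 hab _ (natDegree_etaCoeff_le _ _) (hone _ _ _ _ _ _ hφ) ?_ X hX i hi hi
    intro j hj
    -- The coefficient being estimated is itself an admissible test polynomial, having degree at
    -- most `m` in `ξ`.
    rw [← hφ.jump_laplacian j hj (etaCoeff m (βp • pp - βm • pm) (j + 2))
      (natDegree_etaCoeff_le _ _ _)]
    refine intervalIntegral.integral_congr fun t _ => ?_
    congr 1
    rw [hform _ hφ.mem_plus, hform _ hφ.mem_minus, mul_add, mul_add, Finset.mul_sum,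
      Finset.mul_sum, add_sub_add_comm, ← Finset.sum_sub_distrib]
    simp only [etaCoeff_sub, etaCoeff_smul, Polynomial.eval_sub, Polynomial.eval_smul,
      Polynomial.derivative_sub, Polynomial.derivative_smul, smul_eq_mul]
    congr 1
    · ring
    · refine Finset.sum_congr rfl fun i _ => ?_
      ring
  · refine ⟨1, fun h a b hh hh1 hab βm βp pm pp hφ X hX i hi t ht => ?_⟩
    obtain rfl : i = 0 := by omega
    rw [zero_add, hone _ _ _ _ _ _ hφ t ht]
    simpa using (abs_nonneg _).trans (hX t ht)

/-! ### Closed regular curves and their Frenet map. -/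

section Curve

variable {g : ℝ → Plane} {L : ℝ}

theorem Plane.norm_sq (x : Plane) : ‖x‖ ^ 2 = x 0 ^ 2 + x 1 ^ 2 := by
  simp [EuclideanSpace.norm_sq_eq, Fin.sum_univ_two]

theorem Plane.abs_apply_le (x : Plane) (i : Fin 2) : |x i| ≤ ‖x‖ := by
  simpa using PiLp.norm_apply_le x i

theorem Plane.norm_le_add (x : Plane) : ‖x‖ ≤ |x 0| + |x 1| := by
  refine abs_le_of_sq_le_sq' ?_ (by positivity) |>.2
  rw [Plane.norm_sq]
  nlinarith [abs_nonneg (x 0), abs_nonneg (x 1), sq_abs (x 0), sq_abs (x 1),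
    mul_nonneg (abs_nonneg (x 0)) (abs_nonneg (x 1))]

theorem norm_unitTangent (hreg : ∀ ξ, deriv g ξ ≠ 0) (ξ : ℝ) : ‖unitTangent g ξ‖ = 1 := by
  rw [unitTangent, norm_smul, norm_inv, norm_norm, inv_mul_cancel₀ (norm_ne_zero_iff.2 (hreg ξ))]

theorem norm_unitNormal (hreg : ∀ ξ, deriv g ξ ≠ 0) (ξ : ℝ) : ‖unitNormal g ξ‖ = 1 := by
  have h1 := Plane.norm_sq (unitNormal g ξ)
  have h2 := Plane.norm_sq (unitTangent g ξ)
  rw [norm_unitTangent hreg] at h2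
  have h3 : ‖unitNormal g ξ‖ ^ 2 = 1 := by
    rw [h1]; simp [unitNormal]; linarith
  exact (pow_eq_one_iff_of_nonneg (norm_nonneg _) two_ne_zero).1 h3

theorem contDiff_unitNormal (hg : ContDiff ℝ 2 g) (hreg : ∀ ξ, deriv g ξ ≠ 0) :
    ContDiff ℝ 1 (unitNormal g) := by
  have h1 : ContDiff ℝ 1 (deriv g) := ContDiff.deriv' (n := 1) hg
  have h2 : ContDiff ℝ 1 (unitTangent g) :=
    ((h1.norm ℝ hreg).inv fun ξ => norm_ne_zero_iff.2 (hreg ξ)).smul h1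
  have h3 := contDiff_euclidean.1 h2
  rw [contDiff_euclidean]
  intro i
  fin_cases i
  · simpa [unitNormal] using h3 1
  · simpa [unitNormal] using (h3 0).neg

theorem exists_lipschitz_of_periodic {f : ℝ → Plane} (hf : ContDiff ℝ 1 f) (hL : 0 < L)
    (hp : Function.Periodic f L) : ∃ M > 0, ∀ x y, ‖f x - f y‖ ≤ M * |x - y| := by
  obtain ⟨M, hM⟩ := exists_abs_le_of_periodic (hf.continuous_deriv le_rfl).norm hL
    (fun ξ => congrArg norm (periodic_deriv hp ξ))
  have hM' : ∀ x, ‖deriv f x‖ ≤ M := fun x => (le_abs_self _).trans (hM x)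
  refine ⟨M + 1, by linarith [(norm_nonneg _).trans (hM' 0)], fun x y => ?_⟩
  have h := convex_univ.norm_image_sub_le_of_norm_deriv_le (f := f) (C := M) (x := y) (y := x)
    (fun t _ => hf.differentiable (by norm_num) t) (fun t _ => hM' t) (mem_univ _) (mem_univ _)
  rw [Real.norm_eq_abs] at h
  nlinarith [abs_nonneg (x - y)]

theorem exists_speed_lower_bound (hg : ContDiff ℝ 1 g) (hL : 0 < L) (hp : Function.Periodic g L)
    (hreg : ∀ ξ, deriv g ξ ≠ 0) : ∃ σ > 0, ∀ ξ, σ ≤ ‖deriv g ξ‖ := by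
  have hpos : ∀ ξ, 0 < ‖deriv g ξ‖ := fun ξ => norm_pos_iff.2 (hreg ξ)
  obtain ⟨M, hM⟩ := exists_abs_le_of_periodic
    ((hg.continuous_deriv le_rfl).norm.inv₀ fun ξ => (hpos ξ).ne') hL
    (fun ξ => congrArg (fun v => ‖v‖⁻¹) (periodic_deriv hp ξ))
  have hM0 : 0 < M := (abs_pos.2 (inv_ne_zero (hpos 0).ne')).trans_le (hM 0)
  refine ⟨M⁻¹, inv_pos.2 hM0, fun ξ => ?_⟩
  rw [inv_le_comm₀ hM0 (hpos ξ)]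
  exact (le_abs_self _).trans (hM ξ)

/-- Mean value inequality for `t ↦ g t - t g'(y)`, whose derivative between `y` and `x` is at most
`M |x - y|`. -/
theorem norm_sub_sub_smul_deriv_le (hg : ContDiff ℝ 1 g) {M : ℝ} (hM0 : 0 ≤ M)
    (hM : ∀ x y, ‖deriv g x - deriv g y‖ ≤ M * |x - y|) (x y : ℝ) :
    ‖g x - g y - (x - y) • deriv g y‖ ≤ M * |x - y| * |x - y| := by
  have hd : ∀ t ∈ segment ℝ y x, HasDerivWithinAt (fun t => g t - t • deriv g y)
      (deriv g t - deriv g y) (segment ℝ y x) t := fun t _ => by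
    have h := ((hg.differentiable (by norm_num) t).hasDerivAt).fun_sub
      ((hasDerivAt_id t).smul_const (deriv g y))
    simp only [one_smul, id] at h
    exact h.hasDerivWithinAt
  have h := (convex_segment y x).norm_image_sub_le_of_norm_hasDerivWithin_le (C := M * |x - y|) hd
    (fun t ht => (hM t y).trans (mul_le_mul_of_nonneg_left
      (abs_sub_left_of_mem_uIcc (by rwa [segment_eq_uIcc] at ht)) hM0))
    (left_mem_segment ℝ y x) (right_mem_segment ℝ y x)
  rw [Real.norm_eq_abs] at h
  have e : g x - g y - (x - y) • deriv g y = g x - x • deriv g y - (g y - y • deriv g y) := by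
    rw [sub_smul]; abel
  rw [e]
  exact h

/-- Reducing both parameters to the basic period shows that they differ by an integer multiple of
`L`, and the only one smaller than `L` is zero. -/
theorem eq_of_periodic_of_injOn {ξs : ℝ} (hL : 0 < L) (hp : Function.Periodic g L)
    (hinj : InjOn g (Ico ξs (ξs + L))) {x y : ℝ} (hxy : g x = g y) (hlt : |x - y| < L) : x = y := by
  have hmod : ∀ z, g (toIcoMod hL ξs z) = g z := fun z => by
    rw [toIcoMod, hp.sub_zsmul_eq]
  have h := hinj (toIcoMod_mem_Ico hL ξs x) (toIcoMod_mem_Ico hL ξs y) (by rw [hmod, hmod, hxy])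
  rw [toIcoMod, toIcoMod, zsmul_eq_mul, zsmul_eq_mul] at h
  have h1 : x - y = ((toIcoDiv hL ξs x - toIcoDiv hL ξs y : ℤ) : ℝ) * L := by push_cast; linarith
  rw [h1, abs_mul, abs_of_pos hL] at hlt
  have h2 : |((toIcoDiv hL ξs x - toIcoDiv hL ξs y : ℤ) : ℝ)| < 1 := by
    by_contra! hcon
    nlinarith
  have h3 : toIcoDiv hL ξs x - toIcoDiv hL ξs y = 0 := by
    rw [← Int.cast_abs] at h2
    exact Int.abs_lt_one_iff.1 (by exact_mod_cast h2)
  rw [h3] at h1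
  simpa [sub_eq_zero] using h1

/-- A closed simple regular curve is bi-Lipschitz on half periods. -/
theorem exists_curve_antilipschitz {ξs : ℝ} (hL : 0 < L) (hp : Function.Periodic g L)
    (hinj : InjOn g (Ico ξs (ξs + L))) (hg : ContDiff ℝ 2 g) (hreg : ∀ ξ, deriv g ξ ≠ 0) :
    ∃ l > 0, ∀ c ξ, |ξ - c| ≤ L / 2 → l * |ξ - c| ≤ ‖g ξ - g c‖ := by
  have hg1 : ContDiff ℝ 1 g := hg.of_le (by norm_num)
  obtain ⟨σ, hσ, hs⟩ := exists_speed_lower_bound hg1 hL hp hreg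
  obtain ⟨M, hM, hlip⟩ := exists_lipschitz_of_periodic (ContDiff.deriv' (n := 1) hg) hL
    (periodic_deriv hp)
  -- Separated pairs, with `c` shifted into one period, form a compact set on which the chord is
  -- positive by injectivity, since `L / 2 < L`. For pairs closer than `σ / (2M)` the linear Taylor
  -- term dominates.
  have hc : IsCompact {x : ℝ × ℝ | (x.1 ∈ Icc 0 L ∧ x.2 ∈ Icc (-L) (2 * L)) ∧
      (σ / (2 * M) ≤ |x.2 - x.1| ∧ |x.2 - x.1| ≤ L / 2)} := by
    refine ((isCompact_Icc (a := (0 : ℝ)) (b := L)).prod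
      (isCompact_Icc (a := -L) (b := 2 * L))).inter_right (t := {x : ℝ × ℝ |
        σ / (2 * M) ≤ |x.2 - x.1| ∧ |x.2 - x.1| ≤ L / 2}) ?_
    exact IsClosed.inter (s₁ := {x : ℝ × ℝ | σ / (2 * M) ≤ |x.2 - x.1|})
      (s₂ := {x : ℝ × ℝ | |x.2 - x.1| ≤ L / 2})
      (isClosed_le (by fun_prop) (by fun_prop)) (isClosed_le (by fun_prop) (by fun_prop))
  have hgc := hg.continuous
  obtain ⟨μ, hμ, hmin⟩ := hc.exists_forall_le' (f := fun x : ℝ × ℝ => ‖g x.2 - g x.1‖)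
    (by fun_prop) (a := 0) (by
      rintro ⟨c, ξ⟩ ⟨_, h1, h2⟩
      simp only [norm_pos_iff, sub_ne_zero] at h1 h2 ⊢
      intro heq
      have := eq_of_periodic_of_injOn hL hp hinj heq (by linarith)
      rw [this, sub_self, abs_zero] at h1
      have : 0 < σ / (2 * M) := by positivity
      linarith)
  refine ⟨min (σ / 2) (μ / (L / 2)), by positivity, fun c ξ hξ => ?_⟩
  by_cases hsmall : |ξ - c| ≤ σ / (2 * M)
  · have h1 := norm_sub_sub_smul_deriv_le hg1 hM.le hlip ξ c
    have h2 := norm_sub_norm_le ((ξ - c) • deriv g c) (g ξ - g c)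
    rw [norm_sub_rev ((ξ - c) • deriv g c), norm_smul, Real.norm_eq_abs] at h2
    have h3 : M * |ξ - c| ≤ σ / 2 := by
      rw [le_div_iff₀ (by positivity)] at hsmall
      linarith
    calc min (σ / 2) (μ / (L / 2)) * |ξ - c| ≤ σ / 2 * |ξ - c| := by
          gcongr; exact min_le_left _ _
      _ ≤ ‖g ξ - g c‖ := by nlinarith [abs_nonneg (ξ - c), hs c]
  · set k := toIcoDiv hL 0 c
    have hmem := toIcoMod_mem_Ico hL 0 c
    rw [toIcoMod, zero_add] at hmem
    have hgp : ∀ z, g (z - k • L) = g z := fun z => hp.sub_zsmul_eq k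
    have hdiff : (ξ - k • L) - (c - k • L) = ξ - c := by abel
    have habs := abs_le.1 hξ
    have h1 := hmin (c - k • L, ξ - k • L) ⟨⟨⟨hmem.1, hmem.2.le⟩, by
      constructor <;> linarith [hmem.1, hmem.2]⟩, by
        simp only [hdiff]; exact ⟨(not_le.1 hsmall).le, hξ⟩⟩
    simp only [hgp] at h1
    calc min (σ / 2) (μ / (L / 2)) * |ξ - c| ≤ μ / (L / 2) * (L / 2) := by
          gcongr; exact min_le_right _ _
      _ = μ := by field_simp
      _ ≤ _ := h1

theorem continuous_frenetMap (hg : ContDiff ℝ 2 g) (hreg : ∀ ξ, deriv g ξ ≠ 0) :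
    Continuous (frenetMap g) := by
  have h1 := hg.continuous
  have h2 := (contDiff_unitNormal hg hreg).continuous
  unfold frenetMap
  fun_prop

theorem periodic_unitNormal (hp : Function.Periodic g L) :
    Function.Periodic (unitNormal g) L := fun x => by
  simp only [unitNormal, unitTangent, periodic_deriv hp x]

/-- The difference of normals is multiplied by `x 0` alone, so only one of the two points needs to
lie in the strip. -/
theorem exists_frenetMap_lipschitz (hL : 0 < L) (hp : Function.Periodic g L)
    (hg : ContDiff ℝ 2 g) (hreg : ∀ ξ, deriv g ξ ≠ 0) :
    ∃ Λ > 0, ∀ x y : Plane, |x 0| ≤ 1 → ‖frenetMap g x - frenetMap g y‖ ≤ Λ * ‖x - y‖ := by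
  obtain ⟨M, hM, h1⟩ := exists_lipschitz_of_periodic (hg.of_le (by norm_num)) hL hp
  obtain ⟨N, hN, h2⟩ := exists_lipschitz_of_periodic (contDiff_unitNormal hg hreg) hL
    (periodic_unitNormal hp)
  refine ⟨M + 1 + N, by positivity, fun x y hx => ?_⟩
  have e : frenetMap g x - frenetMap g y = (g (x 1) - g (y 1)) +
      (x 0 - y 0) • unitNormal g (y 1) + x 0 • (unitNormal g (x 1) - unitNormal g (y 1)) := by
    simp only [frenetMap, sub_smul, smul_sub]; abel
  have a0 := Plane.abs_apply_le (x - y) 0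
  have a1 := Plane.abs_apply_le (x - y) 1
  simp only [PiLp.sub_apply] at a0 a1
  rw [e]
  refine norm_add₃_le.trans ?_
  rw [norm_smul, norm_smul, norm_unitNormal hreg, Real.norm_eq_abs, Real.norm_eq_abs]
  calc _ ≤ M * |x 1 - y 1| + |x 0 - y 0| * 1 + 1 * (N * |x 1 - y 1|) := by
        gcongr
        · exact h1 _ _
        · exact h2 _ _
    _ ≤ M * ‖x - y‖ + ‖x - y‖ * 1 + 1 * (N * ‖x - y‖) := by gcongr
    _ = _ := by ring

/-- Pythagoras for the tangent and the unit normal. It bounds the linear part of the Frenet map from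
below. -/
theorem norm_smul_deriv_add_smul_unitNormal_sq (hreg : ∀ ξ, deriv g ξ ≠ 0) (s t ξ : ℝ) :
    ‖s • deriv g ξ + t • unitNormal g ξ‖ ^ 2 = ‖deriv g ξ‖ ^ 2 * s ^ 2 + t ^ 2 := by
  have h0 := norm_ne_zero_iff.2 (hreg ξ)
  have h1 := Plane.norm_sq (deriv g ξ)
  rw [Plane.norm_sq]
  simp only [PiLp.add_apply, PiLp.smul_apply, smul_eq_mul, unitNormal, unitTangent]
  simp
  field_simp
  linear_combination (-(s ^ 2 * ‖deriv g ξ‖ ^ 2 + t ^ 2)) * h1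

/-- The Frenet transformation is injective, with a Lipschitz inverse, near the interface. -/
theorem exists_frenetMap_antilipschitz (hL : 0 < L) (hp : Function.Periodic g L)
    (hg : ContDiff ℝ 2 g) (hreg : ∀ ξ, deriv g ξ ≠ 0) :
    ∃ t > 0, ∃ ν > 0, ∀ x y : Plane, |x 0| ≤ t → |x 1 - y 1| ≤ t →
      ν * ‖x - y‖ ≤ ‖frenetMap g x - frenetMap g y‖ := by
  have hg1 : ContDiff ℝ 1 g := hg.of_le (by norm_num)
  obtain ⟨σ, hσ, hs⟩ := exists_speed_lower_bound hg1 hL hp hreg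
  obtain ⟨M, hM, h1⟩ := exists_lipschitz_of_periodic (ContDiff.deriv' (n := 1) hg) hL
    (periodic_deriv hp)
  obtain ⟨N, hN, h2⟩ := exists_lipschitz_of_periodic (contDiff_unitNormal hg hreg) hL
    (periodic_unitNormal hp)
  set μ := min σ 1 with hμ
  have hμ0 : 0 < μ := lt_min hσ one_pos
  -- The linear part is at least `μ ‖x - y‖`. This radius makes the remainder at most half of that.
  refine ⟨μ / (2 * (M + N)), by positivity, μ / 2, by positivity, fun x y hx hxy => ?_⟩
  set v := (x 1 - y 1) • deriv g (y 1) + (x 0 - y 0) • unitNormal g (y 1) with hv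
  have e : frenetMap g x - frenetMap g y = v + ((g (x 1) - g (y 1) - (x 1 - y 1) • deriv g (y 1)) +
      x 0 • (unitNormal g (x 1) - unitNormal g (y 1))) := by
    simp only [hv, frenetMap, sub_smul, smul_sub]; abel
  have a1 := Plane.abs_apply_le (x - y) 1
  simp only [PiLp.sub_apply] at a1
  have hv1 : μ * ‖x - y‖ ≤ ‖v‖ := by
    refine abs_le_of_sq_le_sq' ?_ (norm_nonneg v) |>.2
    rw [mul_pow, hv, norm_smul_deriv_add_smul_unitNormal_sq hreg, Plane.norm_sq, mul_add, add_comm]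
    simp only [PiLp.sub_apply]
    have e1 : μ ^ 2 ≤ ‖deriv g (y 1)‖ ^ 2 := by
      gcongr; exact (min_le_left _ _).trans (hs _)
    have e2 : μ ^ 2 ≤ 1 := pow_le_one₀ hμ0.le (min_le_right _ _)
    have := mul_le_mul_of_nonneg_right e1 (sq_nonneg (x 1 - y 1))
    have := mul_le_mul_of_nonneg_right e2 (sq_nonneg (x 0 - y 0))
    linarith
  have hr : ‖(g (x 1) - g (y 1) - (x 1 - y 1) • deriv g (y 1)) +
      x 0 • (unitNormal g (x 1) - unitNormal g (y 1))‖ ≤ μ / 2 * ‖x - y‖ := by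
    refine (norm_add_le _ _).trans ?_
    rw [norm_smul, Real.norm_eq_abs]
    calc _ ≤ M * |x 1 - y 1| * |x 1 - y 1| + |x 0| * (N * |x 1 - y 1|) := by
          gcongr
          · exact norm_sub_sub_smul_deriv_le hg1 hM.le h1 _ _
          · exact h2 _ _
      _ ≤ M * (μ / (2 * (M + N))) * ‖x - y‖ + (μ / (2 * (M + N))) * (N * ‖x - y‖) := by gcongr
      _ = μ / 2 * ‖x - y‖ := by field_simp
  rw [e]
  have := norm_sub_le_norm_add v ((g (x 1) - g (y 1) - (x 1 - y 1) • deriv g (y 1)) +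
      x 0 • (unitNormal g (x 1) - unitNormal g (y 1)))
  linarith

/-- Every point of the plane has Frenet coordinates with `|η|` the distance to the curve. -/
theorem exists_frenetMap_eq (hL : 0 < L) (hp : Function.Periodic g L) (hg : ContDiff ℝ 2 g)
    (hreg : ∀ ξ, deriv g ξ ≠ 0) (y : Plane) (c : ℝ) :
    ∃ x : Plane, frenetMap g x = y ∧ |x 1 - c| ≤ L / 2 ∧ |x 0| ≤ ‖y - g c‖ := by
  have hgc := hg.continuous
  have hgd : ∀ t i, HasDerivAt (fun s => g s i) (deriv g t i) t := fun t i => by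
    simpa [Function.comp_def] using (EuclideanSpace.proj (𝕜 := ℝ) i).hasFDerivAt.comp_hasDerivAt t
      (hg.differentiable (by norm_num) t).hasDerivAt
  obtain ⟨ξ, hξ, hmin⟩ := (isCompact_Icc (a := c - L / 2) (b := c + L / 2)).exists_isMinOn
    (nonempty_Icc.2 (by linarith)) (f := fun t => ‖y - g t‖) (by fun_prop)
  -- By periodicity the minimum over one period is global, so the derivative vanishes even if the
  -- minimizer is an endpoint. Then `y - g ξ` is orthogonal to the tangent, that is, a multiple of
  -- the normal.
  have hglob : ∀ t, ‖y - g ξ‖ ≤ ‖y - g t‖ := fun t => by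
    have hmem := toIcoMod_mem_Ico hL (c - L / 2) t
    have h := isMinOn_iff.1 hmin (toIcoMod hL (c - L / 2) t)
      ⟨hmem.1, by linarith [hmem.2]⟩
    rwa [toIcoMod, hp.sub_zsmul_eq] at h
  have hcrit : (y 0 - g ξ 0) * deriv g ξ 0 + (y 1 - g ξ 1) * deriv g ξ 1 = 0 := by
    have hloc : IsLocalMin (fun t => (y 0 - g t 0) ^ 2 + (y 1 - g t 1) ^ 2) ξ :=
      .of_forall fun t => by
        have h := pow_le_pow_left₀ (norm_nonneg _) (hglob t) 2
        simpa [Plane.norm_sq] using h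
    have hd := (((hgd ξ 0).const_sub (y 0)).fun_pow 2).fun_add
      (((hgd ξ 1).const_sub (y 1)).fun_pow 2)
    have := hloc.hasDerivAt_eq_zero hd
    push_cast at this
    linarith
  have h0 := norm_ne_zero_iff.2 (hreg ξ)
  have h1 := Plane.norm_sq (deriv g ξ)
  set η := ((y 0 - g ξ 0) * deriv g ξ 1 - (y 1 - g ξ 1) * deriv g ξ 0) / ‖deriv g ξ‖ with hη
  have hy : y - g ξ = η • unitNormal g ξ := by
    ext i
    fin_cases i
    · simp [unitNormal, unitTangent, hη]
      field_simp
      rw [h1]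
      linear_combination (deriv g ξ 0) * hcrit
    · simp [unitNormal, unitTangent, hη]
      field_simp
      rw [h1]
      linear_combination (deriv g ξ 1) * hcrit
  refine ⟨!₂[η, ξ], ?_, ?_, ?_⟩
  · simp [frenetMap, ← hy]
  · rw [abs_le]
    constructor <;> simp <;> linarith [hξ.1, hξ.2]
  · have := hglob c
    rw [hy, norm_smul, norm_unitNormal hreg, Real.norm_eq_abs, mul_one] at this
    simpa using this

end Curve

/-! ### Axis-parallel rectangles: interior, diameter and perimeter. -/

section Rectangle

variable {a b : Plane}

theorem rectangle_eq_inter (a b : Plane) :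
    rectangle a b = ⋂ i, (fun x : Plane => x i) ⁻¹' Icc (a i) (b i) := by
  ext x; simp [rectangle]

theorem isClosed_rectangle (a b : Plane) : IsClosed (rectangle a b) := by
  rw [rectangle_eq_inter]
  exact isClosed_iInter fun i => isClosed_Icc.preimage (by fun_prop)

theorem mem_interior_rectangle {x : Plane} :
    x ∈ interior (rectangle a b) ↔ ∀ i, x i ∈ Ioo (a i) (b i) := by
  rw [rectangle_eq_inter, interior_iInter_of_finite, mem_iInter]
  refine forall_congr' fun i => ?_
  have ho : IsOpenMap (fun x : Plane => x i) :=
    (EuclideanSpace.proj (𝕜 := ℝ) i).isOpenMap fun t =>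
      ⟨EuclideanSpace.single i t, by simp⟩
  rw [← ho.preimage_interior_eq_interior_preimage (by fun_prop), interior_Icc]
  rfl

theorem isBounded_rectangle (a b : Plane) : Bornology.IsBounded (rectangle a b) := by
  rw [isBounded_iff_forall_norm_le]
  refine ⟨max |a 0| |b 0| + max |a 1| |b 1|, fun x hx => (Plane.norm_le_add x).trans ?_⟩
  exact add_le_add (abs_le_max_abs_abs (hx 0).1 (hx 0).2) (abs_le_max_abs_abs (hx 1).1 (hx 1).2)

/-- The inequality is strict because an interior point lies off every edge. This later gives `|η| <
h` on `K̂`, so that the cut-off `|η| ≤ h` creates no boundary. -/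
theorem norm_sub_lt_diam_rectangle {x y : Plane} (hx : x ∈ rectangle a b)
    (hy : y ∈ interior (rectangle a b)) : ‖x - y‖ < Metric.diam (rectangle a b) := by
  rw [mem_interior_rectangle] at hy
  have hab : ∀ i, a i ≤ b i := fun i => ((hy i).1.trans (hy i).2).le
  have h1 : dist b a ≤ Metric.diam (rectangle a b) :=
    Metric.dist_le_diam_of_mem (isBounded_rectangle a b) (fun i => ⟨hab i, le_rfl⟩)
      (fun i => ⟨le_rfl, hab i⟩)
  refine lt_of_lt_of_le ?_ h1
  rw [dist_eq_norm]
  refine lt_of_pow_lt_pow_left₀ 2 (norm_nonneg _) ?_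
  rw [Plane.norm_sq, Plane.norm_sq]
  have : ∀ i, (x i - y i) ^ 2 < (b i - a i) ^ 2 := fun i =>
    sq_lt_sq' (by linarith [(hx i).1, (hy i).2]) (by linarith [(hx i).2, (hy i).1])
  simpa using add_lt_add (this 0) (this 1)

theorem sub_le_diam_rectangle (hab : ∀ i, a i ≤ b i) (i : Fin 2) :
    b i - a i ≤ Metric.diam (rectangle a b) := by
  have h1 : dist b a ≤ Metric.diam (rectangle a b) :=
    Metric.dist_le_diam_of_mem (isBounded_rectangle a b) (fun i => ⟨hab i, le_rfl⟩)
      (fun i => ⟨le_rfl, hab i⟩)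
  rw [dist_eq_norm] at h1
  have h2 := (le_abs_self _).trans (Plane.abs_apply_le (b - a) i)
  simp only [PiLp.sub_apply] at h2
  exact h2.trans h1

theorem hausdorffMeasure_vertical_le (v s t : ℝ) :
    Measure.hausdorffMeasure 1 ((fun r => (!₂[v, r] : Plane)) '' Icc s t) ≤
      ENNReal.ofReal (t - s) := by
  have h : LipschitzWith 1 fun r => (!₂[v, r] : Plane) := LipschitzWith.of_dist_le_mul fun x y => by
    simp [EuclideanSpace.dist_eq, Fin.sum_univ_two]
  refine (h.hausdorffMeasure_image_le zero_le_one _).trans_eq ?_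
  rw [hausdorffMeasure_real, Real.volume_Icc]; simp

theorem hausdorffMeasure_horizontal_le (v s t : ℝ) :
    Measure.hausdorffMeasure 1 ((fun r => (!₂[r, v] : Plane)) '' Icc s t) ≤
      ENNReal.ofReal (t - s) := by
  have h : LipschitzWith 1 fun r => (!₂[r, v] : Plane) := LipschitzWith.of_dist_le_mul fun x y => by
    simp [EuclideanSpace.dist_eq, Fin.sum_univ_two]
  refine (h.hausdorffMeasure_image_le zero_le_one _).trans_eq ?_
  rw [hausdorffMeasure_real, Real.volume_Icc]; simp

theorem hausdorffMeasure_frontier_rectangle_le (hab : ∀ i, a i ≤ b i) :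
    Measure.hausdorffMeasure 1 (frontier (rectangle a b)) ≤
      ENNReal.ofReal (4 * Metric.diam (rectangle a b)) := by
  have hsub : frontier (rectangle a b) ⊆
      ((fun r => (!₂[a 0, r] : Plane)) '' Icc (a 1) (b 1) ∪
        (fun r => (!₂[b 0, r] : Plane)) '' Icc (a 1) (b 1)) ∪
      ((fun r => (!₂[r, a 1] : Plane)) '' Icc (a 0) (b 0) ∪
        (fun r => (!₂[r, b 1] : Plane)) '' Icc (a 0) (b 0)) := by
    intro x hx
    rw [(isClosed_rectangle a b).frontier_eq, mem_sdiff, mem_interior_rectangle] at hx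
    obtain ⟨hx, hn⟩ := hx
    push Not at hn
    obtain ⟨i, hi⟩ := hn
    have hx' : !₂[x 0, x 1] = x := by ext j; fin_cases j <;> rfl
    have hor : x i = a i ∨ x i = b i := by
      by_contra! hcon
      exact hi ⟨lt_of_le_of_ne (hx i).1 hcon.1.symm, lt_of_le_of_ne (hx i).2 hcon.2⟩
    fin_cases i
    · rcases hor with h | h <;> simp only [Fin.zero_eta] at h
      · exact .inl (.inl ⟨x 1, hx 1, by simp only [← h, hx']⟩)
      · exact .inl (.inr ⟨x 1, hx 1, by simp only [← h, hx']⟩)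
    · rcases hor with h | h <;> simp only [Fin.mk_one] at h
      · exact .inr (.inl ⟨x 0, hx 0, by simp only [← h, hx']⟩)
      · exact .inr (.inr ⟨x 0, hx 0, by simp only [← h, hx']⟩)
  set h := Metric.diam (rectangle a b)
  have h0 : 0 ≤ h := Metric.diam_nonneg
  have e0 := ENNReal.ofReal_le_ofReal (sub_le_diam_rectangle hab 0)
  have e1 := ENNReal.ofReal_le_ofReal (sub_le_diam_rectangle hab 1)
  refine (measure_mono hsub).trans ((measure_union_le _ _).trans ?_)
  calc _ ≤ (ENNReal.ofReal h + ENNReal.ofReal h) + (ENNReal.ofReal h + ENNReal.ofReal h) :=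
        add_le_add
          ((measure_union_le _ _).trans (add_le_add ((hausdorffMeasure_vertical_le _ _ _).trans e1)
            ((hausdorffMeasure_vertical_le _ _ _).trans e1)))
          ((measure_union_le _ _).trans
            (add_le_add ((hausdorffMeasure_horizontal_le _ _ _).trans e0)
              ((hausdorffMeasure_horizontal_le _ _ _).trans e0)))
    _ = ENNReal.ofReal (4 * h) := by
      rw [← ENNReal.ofReal_add h0 h0, ← ENNReal.ofReal_add (by linarith) (by linarith)]
      congr 1; ring

end Rectangle

/-! ### Shape and size of the Frenet elements. -/

/-- Geometry of the Frenet elements of a shape-regular family of rectangles. -/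
theorem exists_frenetElement_geometry {g : ℝ → Plane} {L ξs : ℝ} (hL : 0 < L)
    (hp : Function.Periodic g L) (hinj : InjOn g (Ico ξs (ξs + L))) (hg : ContDiff ℝ 2 g)
    (hreg : ∀ ξ, deriv g ξ ≠ 0) {ρ : ℝ} (hρ : 0 < ρ) :
    ∃ h₀ > 0, ∃ θ > 0, ∃ Θ > 0, ∀ a b : Plane,
      (∀ i, ρ * Metric.diam (rectangle a b) ≤ b i - a i) →
      Metric.diam (rectangle a b) < h₀ → ∀ c : ℝ, g c ∈ interior (rectangle a b) →
      0 < Metric.diam (rectangle a b) ∧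
      BijOn (frenetMap g) (frenetElement g L c (rectangle a b)) (rectangle a b) ∧
      IsClosed (frenetElement g L c (rectangle a b)) ∧
      (∀ x ∈ frenetElement g L c (rectangle a b),
        |x 1 - c| ≤ Θ * Metric.diam (rectangle a b)) ∧
      Measure.hausdorffMeasure 1 (frontier (frenetElement g L c (rectangle a b))) ≤
        ENNReal.ofReal (Θ * Metric.diam (rectangle a b)) ∧
      ∃ x₀ : Plane, ∀ x : Plane, (∀ i, |x i - x₀ i| ≤ θ * Metric.diam (rectangle a b)) →
        x ∈ frenetElement g L c (rectangle a b) := by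
  obtain ⟨l, hl, hanti⟩ := exists_curve_antilipschitz hL hp hinj hg hreg
  obtain ⟨Λ, hΛ, hlip⟩ := exists_frenetMap_lipschitz hL hp hg hreg
  obtain ⟨t, ht, ν, hν, hlow⟩ := exists_frenetMap_antilipschitz hL hp hg hreg
  have hcont := continuous_frenetMap hg hreg
  -- The Frenet map sends a square of half side `θ h` to within `ρ h / 2` of the image of its
  -- centre. If that image is the centre of `K`, the square is mapped into `K`.
  set θ := min 1 (ρ / (4 * Λ)) with hθ
  have hθ0 : 0 < θ := lt_min one_pos (by positivity)
  have hθ1 : θ ≤ 1 := min_le_left _ _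
  have hθρ : Λ * (2 * θ) ≤ ρ / 2 := by
    have : θ ≤ ρ / (4 * Λ) := min_le_right _ _
    rw [le_div_iff₀ (by positivity)] at this
    linarith
  -- Parameters in `K̂` lie within `2h / l` of `c`, so two of them differ by at most `4h / l`; the
  -- `2` leaves room for the inner square. The bounds on `W h` ensure local injectivity and keep
  -- `K̂` away from `|ξ - c| = L / 2`.
  set W := 4 / l + 2 with hW
  have hW0 : 0 < W := by positivity
  refine ⟨min (min (1 / 2) (t / W)) (L / (4 * W)), by positivity, θ, hθ0, 2 / l + 4 / ν,
    by positivity, fun a b hab hdiam c hc => ?_⟩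
  set K := rectangle a b with hK
  set h := Metric.diam K with hh
  set F := frenetElement g L c K with hF
  have hh0 : 0 < h := by
    have := norm_sub_lt_diam_rectangle (interior_subset hc) hc
    simpa using this
  have hh1 : h < 1 / 2 := hdiam.trans_le ((min_le_left _ _).trans (min_le_left _ _))
  have hht : W * h ≤ t := by
    have := hdiam.le.trans ((min_le_left _ _).trans (min_le_right _ _))
    rwa [le_div_iff₀ hW0, mul_comm] at this
  have hhL : W * h < L / 2 := by
    have := hdiam.trans_le (min_le_right _ _)
    rw [lt_div_iff₀ (by positivity)] at this
    linarith
  have hlh : 0 < h / l := by positivity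
  have hWh : W * h = 4 * (h / l) + 2 * h := by rw [hW]; ring
  have hle : ∀ i, a i ≤ b i := fun i => by
    have := mul_pos hρ hh0
    linarith [hab i]
  have hKd : ∀ y ∈ K, ‖y - g c‖ < h := fun y hy => norm_sub_lt_diam_rectangle hy hc
  have hξ : ∀ x ∈ F, |x 1 - c| ≤ 2 * (h / l) := by
    intro x hx
    have h1 := hanti c (x 1) hx.2.1
    have h2 : g (x 1) - g c = (frenetMap g x - g c) - x 0 • unitNormal g (x 1) := by
      simp only [frenetMap]; abel
    have h3 : ‖g (x 1) - g c‖ ≤ h + h := by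
      rw [h2]
      refine (norm_sub_le _ _).trans (add_le_add (hKd _ hx.2.2).le ?_)
      rw [norm_smul, norm_unitNormal hreg, mul_one]
      exact hx.1
    have h4 : |x 1 - c| ≤ 2 * h / l := by rw [le_div_iff₀ hl]; linarith
    rwa [mul_div_assoc] at h4
  have hlowF : ∀ x ∈ F, ∀ y ∈ F, ν * ‖x - y‖ ≤ ‖frenetMap g x - frenetMap g y‖ := by
    intro x hx y hy
    refine hlow x y (by linarith [hx.1]) ?_
    have e : x 1 - y 1 = (x 1 - c) - (y 1 - c) := by ring
    rw [e]
    refine (abs_sub _ _).trans ?_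
    linarith [hξ x hx, hξ y hy]
  have hinjF : InjOn (frenetMap g) F := by
    intro x hx y hy hxy
    have := hlowF x hx y hy
    rw [hxy, sub_self, norm_zero] at this
    have h0 : ‖x - y‖ ≤ 0 := by
      by_contra! hcon
      have := mul_pos hν hcon
      linarith
    exact sub_eq_zero.1 (norm_le_zero_iff.1 h0)
  have hpre : ∀ y ∈ K, ∃ x ∈ F, frenetMap g x = y ∧ |x 0| < h := by
    intro y hy
    obtain ⟨x, hx, hx1, hx0⟩ := exists_frenetMap_eq hL hp hg hreg y c
    have hlt := hx0.trans_lt (hKd y hy)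
    exact ⟨x, ⟨hlt.le, hx1, hx ▸ hy⟩, hx, hlt⟩
  have hbij : BijOn (frenetMap g) F K :=
    ⟨fun x hx => hx.2.2, hinjF, fun y hy => by
      obtain ⟨x, hx, hxy, _⟩ := hpre y hy
      exact ⟨x, hx, hxy⟩⟩
  -- By injectivity every point of `K̂` is the closest-point preimage, which satisfies the strict
  -- bound.
  have hη : ∀ x ∈ F, |x 0| < h := by
    intro x hx
    obtain ⟨x', hx', hxx', hlt⟩ := hpre _ hx.2.2
    rwa [← hinjF hx' hx hxx']
  have hclosed : IsClosed F := by
    refine IsClosed.inter (s₁ := {x : Plane | |x 0| ≤ h}) (isClosed_le (by fun_prop) (by fun_prop))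
      (IsClosed.inter (s₁ := {x : Plane | |x 1 - c| ≤ L / 2})
        (isClosed_le (by fun_prop) (by fun_prop)) ((isClosed_rectangle a b).preimage hcont))
  -- Both bounds on the coordinates are inactive, so only the condition of lying in `K` produces
  -- boundary. The length then follows from the Lipschitz inverse.
  have hfront : frontier F ⊆ Function.invFunOn (frenetMap g) F '' frontier K := by
    intro x hx
    rw [hclosed.frontier_eq] at hx
    obtain ⟨hxF, hxi⟩ := hx
    refine ⟨frenetMap g x, ?_, hinjF.leftInvOn_invFunOn hxF⟩
    rw [(isClosed_rectangle a b).frontier_eq]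
    refine ⟨hxF.2.2, fun hint => hxi ?_⟩
    rw [mem_interior]
    refine ⟨({x : Plane | |x 0| < h} ∩ {x : Plane | |x 1 - c| < L / 2}) ∩
      frenetMap g ⁻¹' interior K, ?_, ?_, ⟨hη x hxF, ?_⟩, hint⟩
    · rintro y ⟨⟨hy0, hy1⟩, hy2⟩
      exact ⟨le_of_lt hy0, le_of_lt hy1, interior_subset hy2⟩
    · exact ((isOpen_lt (by fun_prop) (by fun_prop)).inter
        (isOpen_lt (by fun_prop) (by fun_prop))).inter (isOpen_interior.preimage hcont)
    · exact (hξ x hxF).trans_lt (by linarith)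
  have hinvlip : LipschitzOnWith (Real.toNNReal ν⁻¹) (Function.invFunOn (frenetMap g) F) (frontier K) := by
    refine LipschitzOnWith.of_dist_le_mul fun y hy z hz => ?_
    have hy' := (isClosed_rectangle a b).frontier_subset hy
    have hz' := (isClosed_rectangle a b).frontier_subset hz
    have e1 := hlowF _ (hbij.surjOn.mapsTo_invFunOn hy') _ (hbij.surjOn.mapsTo_invFunOn hz')
    rw [hbij.surjOn.rightInvOn_invFunOn hy', hbij.surjOn.rightInvOn_invFunOn hz'] at e1
    rw [Real.coe_toNNReal _ (by positivity), dist_eq_norm, dist_eq_norm,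
      inv_mul_eq_div, le_div_iff₀' hν]
    exact e1
  refine ⟨hh0, hbij, hclosed, fun x hx => ?_, ?_, ?_⟩
  · refine (hξ x hx).trans ?_
    have : 0 < 4 / ν * h := by positivity
    rw [add_mul, ← mul_div_assoc, div_mul_eq_mul_div]
    linarith
  · refine (measure_mono hfront).trans ((hinvlip.hausdorffMeasure_image_le zero_le_one).trans ?_)
    rw [ENNReal.rpow_one]
    refine (mul_le_mul_right (hausdorffMeasure_frontier_rectangle_le hle) _).trans ?_
    rw [← ENNReal.ofReal, ← ENNReal.ofReal_mul (by positivity)]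
    refine ENNReal.ofReal_le_ofReal ?_
    have : 0 < 2 / l * h := by positivity
    calc ν⁻¹ * (4 * h) = 4 / ν * h := by ring
      _ ≤ (2 / l + 4 / ν) * h := by linarith
  · obtain ⟨x₀, hx₀, hx₀y, _⟩ := hpre ((1 / 2 : ℝ) • (a + b)) (fun i => by
      simp only [PiLp.smul_apply, PiLp.add_apply, smul_eq_mul]
      constructor <;> linarith [hle i])
    refine ⟨x₀, fun x hx => ?_⟩
    have hθh : θ * h ≤ h := mul_le_of_le_one_left hh0.le hθ1
    have hx0 : |x 0| ≤ 2 * h := by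
      have := abs_add_le (x 0 - x₀ 0) (x₀ 0)
      rw [sub_add_cancel] at this
      linarith [hx 0, hx₀.1]
    have hx1 : |x 1 - c| ≤ 2 * (h / l) + h := by
      have := abs_add_le (x 1 - x₀ 1) (x₀ 1 - c)
      rw [sub_add_sub_cancel] at this
      linarith [hx 1, hξ x₀ hx₀]
    have hxK : frenetMap g x ∈ K := by
      have h1 := hlip x x₀ (by linarith)
      have h2 := Plane.norm_le_add (x - x₀)
      simp only [PiLp.sub_apply] at h2
      have h3 : ‖x - x₀‖ ≤ 2 * θ * h := by linarith [hx 0, hx 1]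
      have h4 : ‖frenetMap g x - frenetMap g x₀‖ ≤ ρ / 2 * h := by
        calc _ ≤ Λ * (2 * θ * h) := h1.trans (by gcongr)
          _ = Λ * (2 * θ) * h := by ring
          _ ≤ _ := by gcongr
      intro i
      have h5 := (Plane.abs_apply_le (frenetMap g x - frenetMap g x₀) i).trans h4
      rw [hx₀y] at h5
      simp only [PiLp.sub_apply, PiLp.smul_apply, PiLp.add_apply, smul_eq_mul] at h5
      obtain ⟨h6, h7⟩ := abs_le.1 h5
      constructor <;> linarith [hab i]
    -- So far only `|x 0| ≤ 2h` is known. The preimage of the same point inside `K̂` must equal `x`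
    -- by injectivity on the larger neighbourhood.
    obtain ⟨x', hx', hxx', _⟩ := hpre _ hxK
    have h1 := hlow x x' (by linarith) (by
      have := abs_sub (x 1 - c) (x' 1 - c)
      rw [sub_sub_sub_cancel_right] at this
      linarith [hξ x' hx'])
    rw [hxx', sub_self, norm_zero] at h1
    have h0 : ‖x - x'‖ ≤ 0 := by
      by_contra! hcon
      have := mul_pos hν hcon
      linarith
    rwa [sub_eq_zero.1 (norm_le_zero_iff.1 h0)]

/-! ### Estimates on squares and transfer between the two pieces. -/

theorem measurePreserving_plane :
    MeasurePreserving (fun x : Plane => (x 0, x 1)) volume (volume : Measure (ℝ × ℝ)) :=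
  (volume_preserving_finTwoArrow ℝ).comp
    (EuclideanSpace.volume_preserving_symm_measurableEquiv_toLp (Fin 2))

theorem continuous_polyFun (p : MvPolynomial (Fin 2) ℝ) :
    Continuous fun x : ℝ × ℝ => polyFun p x.1 x.2 := by
  unfold polyFun
  refine (MvPolynomial.continuous_eval p).comp (continuous_pi fun i => ?_)
  fin_cases i
  · exact continuous_fst
  · exact continuous_snd

/-- The closed square with lower left corner `(a₀, a₁)` and side `r`. -/
def closedSquare (a₀ a₁ r : ℝ) : Set Plane :=
  {x | x 0 ∈ Icc a₀ (a₀ + r) ∧ x 1 ∈ Icc a₁ (a₁ + r)}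

theorem setLIntegral_closedSquare {F : ℝ × ℝ → ENNReal} (hF : Measurable F) (a₀ a₁ r : ℝ) :
    ∫⁻ x in closedSquare a₀ a₁ r, F (x 0, x 1) =
      ∫⁻ s in Icc a₀ (a₀ + r), ∫⁻ t in Icc a₁ (a₁ + r), F (s, t) := by
  have h := measurePreserving_plane.setLIntegral_comp_preimage
    (s := Icc a₀ (a₀ + r) ×ˢ Icc a₁ (a₁ + r)) (measurableSet_Icc.prod measurableSet_Icc) hF
  rw [Measure.volume_eq_prod, ← Measure.prod_restrict, lintegral_prod _ hF.aemeasurable] at h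
  exact h

/-- A bivariate polynomial is bounded, at points comparably close to a square, by its mean square
on that square. -/
theorem exists_polyFun_sq_le (m : ℕ) {T : ℝ} (hT : 0 ≤ T) :
    ∃ C > 0, ∀ p ∈ MvPolynomial.restrictDegree (Fin 2) ℝ m, ∀ a₀ a₁ r η ξ : ℝ, 0 < r →
      |η - a₀| ≤ T * r → |ξ - a₁| ≤ T * r →
      ENNReal.ofReal (polyFun p η ξ ^ 2) ≤ ENNReal.ofReal (C / r ^ 2) *
        ∫⁻ x in closedSquare a₀ a₁ r, ENNReal.ofReal (polyFun p (x 0) (x 1) ^ 2) := by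
  obtain ⟨C, hC, H⟩ := exists_eval_sq_le_lintegral m hT
  refine ⟨C * C, by positivity, fun p hp a₀ a₁ r η ξ hr hη hξ => ?_⟩
  have hxi : ∀ s, ∃ q : Polynomial ℝ, q.natDegree ≤ m ∧ ∀ t, q.eval t = polyFun p s t := fun s =>
    ⟨∑ i ∈ Finset.range (m + 1), s ^ i • etaCoeff m p i,
      Polynomial.natDegree_sum_le_of_forall_le _ _ fun i _ =>
        (Polynomial.natDegree_smul_le _ _).trans (natDegree_etaCoeff_le m p i),
      fun t => by simp [polyFun_eq_sum hp, Polynomial.eval_finsetSum]⟩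
  have h1 := H (etaPoly m p ξ) (natDegree_etaPoly_le m p ξ) a₀ r η hr hη
  simp only [eval_etaPoly hp] at h1
  have h2 : ∀ s, ENNReal.ofReal (polyFun p s ξ ^ 2) ≤ ENNReal.ofReal (C / r) *
      ∫⁻ t in Icc a₁ (a₁ + r), ENNReal.ofReal (polyFun p s t ^ 2) := fun s => by
    obtain ⟨q, hq, he⟩ := hxi s
    simpa only [he] using H q hq a₁ r ξ hr hξ
  have hmeas : Measurable fun x : ℝ × ℝ => ENNReal.ofReal (polyFun p x.1 x.2 ^ 2) :=
    ENNReal.measurable_ofReal.comp ((continuous_polyFun p).pow 2).measurable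
  have h3 := setLIntegral_closedSquare hmeas a₀ a₁ r
  simp only at h3
  rw [h3]
  calc ENNReal.ofReal (polyFun p η ξ ^ 2)
      ≤ ENNReal.ofReal (C / r) * ∫⁻ s in Icc a₀ (a₀ + r), ENNReal.ofReal (C / r) *
        ∫⁻ t in Icc a₁ (a₁ + r), ENNReal.ofReal (polyFun p s t ^ 2) :=
        h1.trans (by gcongr; exact h2 _)
    _ = _ := by
      rw [lintegral_const_mul' _ _ ENNReal.ofReal_ne_top, ← mul_assoc,
        ← ENNReal.ofReal_mul (by positivity)]
      congr 2
      field_simp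

theorem enorm_sq_eq_ofReal (v : Plane) : ‖v‖ₑ ^ 2 = ENNReal.ofReal (‖v‖ ^ 2) := by
  rw [← ofReal_norm, ENNReal.ofReal_pow (norm_nonneg v)]

theorem ofReal_polyFun_pderiv_sq_le (p : MvPolynomial (Fin 2) ℝ) (i : Fin 2) (x : Plane) :
    ENNReal.ofReal (polyFun (MvPolynomial.pderiv i p) (x 0) (x 1) ^ 2) ≤ ‖polyGrad p x‖ₑ ^ 2 := by
  rw [enorm_sq_eq_ofReal]
  refine ENNReal.ofReal_le_ofReal ?_
  have h := Plane.abs_apply_le (polyGrad p x) i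
  have h' : polyGrad p x i = polyFun (MvPolynomial.pderiv i p) (x 0) (x 1) := by
    fin_cases i <;> rfl
  rw [h'] at h
  rw [← sq_abs]
  gcongr

theorem enorm_sqrt_smul_sq {β : ℝ} (hβ : 0 ≤ β) (v : Plane) :
    ‖Real.sqrt β • v‖ₑ ^ 2 = ENNReal.ofReal β * ‖v‖ₑ ^ 2 := by
  rw [enorm_sq_eq_ofReal, enorm_sq_eq_ofReal, ← ENNReal.ofReal_mul hβ, norm_smul, mul_pow,
    Real.norm_eq_abs, sq_abs, Real.sq_sqrt hβ]

theorem etaCoeff_zero_eq_of_jump_value {g : ℝ → Plane} {m : ℕ} {βm βp a b : ℝ}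
    {pm pp : MvPolynomial (Fin 2) ℝ} (hφ : IsFrenetIFE g m βm βp a b pm pp) (hab : a < b) :
    etaCoeff m pp 0 = etaCoeff m pm 0 := by
  refine Polynomial.eq_of_infinite_eval_eq _ _ ((Icc_infinite hab).mono fun t ht => ?_)
  have h := hφ.jump_value t ht
  rw [polyFun_zero_left hφ.mem_plus, polyFun_zero_left hφ.mem_minus, sub_eq_zero] at h
  exact h

/-- A bound for the gradient of one of the two pieces of a Frenet IFE function gives a bound for
the weighted gradients of both pieces. -/
theorem weighted_gradient_le {g : ℝ → Plane} {m : ℕ} {βm βp a b : ℝ}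
    {pm pp : MvPolynomial (Fin 2) ℝ} (hφ : IsFrenetIFE g m βm βp a b pm pp) (hab : a < b)
    (hβm : 0 < βm) (hβ : βm ≤ βp) {C h G : ℝ} (hC : 0 ≤ C) (hG : 0 ≤ G) (hh : 0 ≤ h)
    (hext : ∀ X : ℝ, (∀ ξ ∈ Icc a b,
        |polyFun (MvPolynomial.pderiv 1 (βp • pp - βm • pm)) 0 ξ| ≤ X) →
      ∀ η, |η| ≤ h → ∀ ξ ∈ Icc a b,
        |polyFun (MvPolynomial.pderiv 0 (βp • pp - βm • pm)) η ξ| ≤ C * X ∧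
        |polyFun (MvPolynomial.pderiv 1 (βp • pp - βm • pm)) η ξ| ≤ C * X)
    (hpG : (∀ i, ∀ η, |η| ≤ h → ∀ ξ ∈ Icc a b, |polyFun (MvPolynomial.pderiv i pm) η ξ| ≤ G) ∨
      (∀ i, ∀ η, |η| ≤ h → ∀ ξ ∈ Icc a b, |polyFun (MvPolynomial.pderiv i pp) η ξ| ≤ G)) :
    ∀ i, ∀ η, |η| ≤ h → ∀ ξ ∈ Icc a b,
      |βm * polyFun (MvPolynomial.pderiv i pm) η ξ| ≤ (C + 1) * (βp * G) ∧
      |βp * polyFun (MvPolynomial.pderiv i pp) η ξ| ≤ (C + 1) * (βp * G) := by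
  have hβp : 0 < βp := hβm.trans_le hβ
  have hsplit : ∀ i η ξ, polyFun (MvPolynomial.pderiv i (βp • pp - βm • pm)) η ξ =
      βp * polyFun (MvPolynomial.pderiv i pp) η ξ -
        βm * polyFun (MvPolynomial.pderiv i pm) η ξ := fun i η ξ => by
    rw [map_sub, Derivation.map_smul, Derivation.map_smul, polyFun_sub, polyFun_smul, polyFun_smul]
  have htr : ∀ ξ, polyFun (MvPolynomial.pderiv 1 pp) 0 ξ =
      polyFun (MvPolynomial.pderiv 1 pm) 0 ξ := fun ξ => by
    rw [polyFun_zero_left (pderiv_mem_restrictDegree hφ.mem_plus 1),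
      polyFun_zero_left (pderiv_mem_restrictDegree hφ.mem_minus 1),
      etaCoeff_pderiv_one hφ.mem_plus, etaCoeff_pderiv_one hφ.mem_minus,
      etaCoeff_zero_eq_of_jump_value hφ hab]
  -- On the interface `∂_ξ q = (β⁺ - β⁻) ∂_ξ φ`, and the tangential derivative is common to both
  -- pieces, so whichever piece is bounded serves.
  have hX : ∀ ξ ∈ Icc a b,
      |polyFun (MvPolynomial.pderiv 1 (βp • pp - βm • pm)) 0 ξ| ≤ βp * G := by
    intro ξ hξ
    have hG' : |polyFun (MvPolynomial.pderiv 1 pm) 0 ξ| ≤ G := by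
      rcases hpG with h | h
      · exact h 1 0 (by simpa using hh) ξ hξ
      · rw [← htr]; exact h 1 0 (by simpa using hh) ξ hξ
    rw [hsplit, htr, ← sub_mul, abs_mul, abs_of_nonneg (sub_nonneg.2 hβ)]
    gcongr
    linarith
  intro i η hη ξ hξ
  have hq : |βp * polyFun (MvPolynomial.pderiv i pp) η ξ -
      βm * polyFun (MvPolynomial.pderiv i pm) η ξ| ≤ C * (βp * G) := by
    rw [← hsplit]
    have := hext _ hX η hη ξ hξ
    fin_cases i
    · exact this.1
    · exact this.2
  have hCG : 0 ≤ C * (βp * G) := by positivity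
  rcases hpG with h | h
  · have h1 : |βm * polyFun (MvPolynomial.pderiv i pm) η ξ| ≤ βp * G := by
      rw [abs_mul, abs_of_pos hβm]
      gcongr
      exact h i η hη ξ hξ
    have h2 := abs_sub_abs_le_abs_sub (βp * polyFun (MvPolynomial.pderiv i pp) η ξ)
      (βm * polyFun (MvPolynomial.pderiv i pm) η ξ)
    constructor <;> linarith
  · have h1 : |βp * polyFun (MvPolynomial.pderiv i pp) η ξ| ≤ βp * G := by
      rw [abs_mul, abs_of_pos hβp]
      gcongr
      exact h i η hη ξ hξ
    have h2 := abs_sub_abs_le_abs_sub (βm * polyFun (MvPolynomial.pderiv i pm) η ξ)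
      (βp * polyFun (MvPolynomial.pderiv i pp) η ξ)
    rw [abs_sub_comm] at h2
    constructor <;> linarith

/-- The restriction to `A` is discarded: the polynomials are bounded on all of `S`, so each
one-sided trace may be integrated over the whole boundary. -/
theorem setLIntegral_weighted_polyGrad_le {μ : Measure Plane} {S : Set Plane}
    (hS : MeasurableSet S) (A : Set Plane) {p : MvPolynomial (Fin 2) ℝ} {w Y : ℝ}
    (hY : ∀ x ∈ S, ∀ i, |w * polyFun (MvPolynomial.pderiv i p) (x 0) (x 1)| ≤ Y) :
    ∫⁻ x in A, ‖w • polyGrad p x‖ₑ ^ 2 ∂(μ.restrict S) ≤ ENNReal.ofReal (4 * Y ^ 2) * μ S := by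
  refine (setLIntegral_le_lintegral _ _).trans ?_
  rw [← setLIntegral_const]
  refine setLIntegral_mono' hS fun x hx => ?_
  rw [enorm_sq_eq_ofReal]
  refine ENNReal.ofReal_le_ofReal ?_
  have h := Plane.norm_le_add (w • polyGrad p x)
  have h0 := hY x hx 0
  have h1 := hY x hx 1
  simp only [PiLp.smul_apply, smul_eq_mul, polyGrad] at h h0 h1
  have h2 : ‖w • polyGrad p x‖ ≤ 2 * Y := h.trans (by simpa [two_mul] using add_le_add h0 h1)
  calc ‖w • polyGrad p x‖ ^ 2 ≤ (2 * Y) ^ 2 := by gcongr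
    _ = 4 * Y ^ 2 := by ring

theorem ofReal_mul_lintegral_le_of_square_subset {Q F A : Set Plane} {β : ℝ} (hβ : 0 ≤ β)
    (hA : MeasurableSet A) (hQF : Q ⊆ F) (hQA : Q ⊆ A)
    (p : MvPolynomial (Fin 2) ℝ) :
    ENNReal.ofReal β * ∫⁻ x in Q, ‖polyGrad p x‖ₑ ^ 2 ≤
      ∫⁻ x in A, ‖Real.sqrt β • polyGrad p x‖ₑ ^ 2 ∂(volume.restrict F) := by
  rw [Measure.restrict_restrict hA, ← lintegral_const_mul' _ _ ENNReal.ofReal_ne_top]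
  simp only [enorm_sqrt_smul_sq hβ]
  exact lintegral_mono_set (subset_inter hQA hQF)

/-! ### The trace inequality. -/

theorem theorem3
    -- the interface: a closed simple regular curve of class `C^2` and `C^{m+1}`, with its
    -- periodic extension
    (m : ℕ) (g : ℝ → Plane) (ξs ξe : ℝ) (hξ : ξs < ξe)
    (hper : Function.Periodic g (ξe - ξs))
    (hinj : Set.InjOn g (Set.Ico ξs ξe))
    (hsmooth₂ : ContDiff ℝ 2 g)
    (hsmooth : ContDiff ℝ (m + 1) g)
    (hreg : ∀ ξ, deriv g ξ ≠ 0)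
    -- shape regularity of the rectangular meshes
    (ρ : ℝ) (hρ : 0 < ρ) :
    ∃ h₀ > 0, ∃ C > 0,
      -- every interface element `K = rectangle a b` of diameter less than `h₀`
      ∀ a b : Plane, (∀ i, ρ * Metric.diam (rectangle a b) ≤ b i - a i) →
      Metric.diam (rectangle a b) < h₀ →
      ∀ c : ℝ, g c ∈ interior (rectangle a b) →
      -- `K̂` is well defined: the Frenet transformation is invertible from `K̂` onto `K`
      Set.BijOn (frenetMap g) (frenetElement g (ξe - ξs) c (rectangle a b)) (rectangle a b) ∧
      -- every pair of coefficients and every Frenet IFE function on `K̂`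
      ∀ βm βp : ℝ, 0 < βm → βm ≤ βp →
      ∀ pm pp : MvPolynomial (Fin 2) ℝ,
      IsFrenetIFE g m βm βp
        (xiLeft (frenetElement g (ξe - ξs) c (rectangle a b)))
        (xiRight (frenetElement g (ξe - ξs) c (rectangle a b))) pm pp →
      brokenGradNorm
          ((Measure.hausdorffMeasure 1).restrict
            (frontier (frenetElement g (ξe - ξs) c (rectangle a b))))
          βm βp pm pp ≤
        ENNReal.ofReal
            (C * (βp / Real.sqrt βm) * Metric.diam (rectangle a b) ^ (-(1 / 2) : ℝ)) *
          brokenGradNorm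
            (volume.restrict (frenetElement g (ξe - ξs) c (rectangle a b)))
            (Real.sqrt βm) (Real.sqrt βp) pm pp := by
  have hL : 0 < ξe - ξs := sub_pos.2 hξ
  obtain ⟨h₁, hh₁, θ, hθ, Θ, hΘ, hgeo⟩ := exists_frenetElement_geometry (ξs := ξs) hL hper
    (by rwa [add_sub_cancel]) hsmooth₂ hreg hρ
  obtain ⟨C₁, hC₁, hext⟩ := exists_gradient_sub_le hL hper hsmooth hreg hθ
  -- From the corner of the inner square to a point of `[-h, h] × [ξ₀, ξ₁]` the distance is at most
  -- `(2 + θ) h` in `η` and `2 Θ h` in `ξ`. `T` is the sum of these divided by the side `θ h`.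
  obtain ⟨C₂, hC₂, hbox⟩ := exists_polyFun_sq_le m
    (T := (2 + θ + 2 * Θ) / θ) (by positivity)
  -- Two pieces, each contributing `4 Y²` times the length `Θ h`, where `Y = (C₁ + 1) βp G` and `G²
  -- = C₂ / (θ h)²` times the energy on the square.
  obtain ⟨D, hD⟩ : ∃ D, D = 8 * (C₁ + 1) ^ 2 * Θ * C₂ / θ ^ 2 := ⟨_, rfl⟩
  have hD0 : 0 < D := by rw [hD]; positivity
  refine ⟨min h₁ 1, by positivity, Real.sqrt D, Real.sqrt_pos.2 hD0, fun a b hab hdiam c hc => ?_⟩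
  obtain ⟨hh0, hbij, hclosed, hFc, hH1, x₀, hx₀⟩ :=
    hgeo a b hab (hdiam.trans_le (min_le_left _ _)) c hc
  refine ⟨hbij, fun βm βp hβm hβ pm pp hφ => ?_⟩
  have hh1 : Metric.diam (rectangle a b) ≤ 1 := hdiam.le.trans (min_le_right _ _)
  have hFη : ∀ x ∈ frenetElement g (ξe - ξs) c (rectangle a b),
    |x 0| ≤ Metric.diam (rectangle a b) := fun x hx => hx.1
  generalize Metric.diam (rectangle a b) = h at *
  generalize frenetElement g (ξe - ξs) c (rectangle a b) = F at *
  have hβp : 0 < βp := hβm.trans_le hβ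
  -- the `ξ`-range of the element
  have hθh : 0 < θ * h := by positivity
  have hx₀F : x₀ ∈ F := hx₀ x₀ (by simp [hθh.le])
  have himg : (fun x : Plane => x 1) '' F ⊆ Icc (c - Θ * h) (c + Θ * h) := by
    rintro _ ⟨x, hx, rfl⟩
    have := abs_le.1 (hFc x hx)
    constructor <;> simp only <;> linarith
  have hmemI : ∀ x ∈ F, x 1 ∈ Icc (xiLeft F) (xiRight F) := fun x hx =>
    ⟨csInf_le (bddBelow_Icc.mono himg) ⟨x, hx, rfl⟩, le_csSup (bddAbove_Icc.mono himg) ⟨x, hx, rfl⟩⟩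
  have hIc : ∀ ξ ∈ Icc (xiLeft F) (xiRight F), |ξ - c| ≤ Θ * h := by
    intro ξ hξ
    have h1 : c - Θ * h ≤ xiLeft F :=
      le_csInf ⟨_, x₀, hx₀F, rfl⟩ fun y hy => (himg hy).1
    have h2 : xiRight F ≤ c + Θ * h :=
      csSup_le ⟨_, x₀, hx₀F, rfl⟩ fun y hy => (himg hy).2
    rw [abs_le]
    constructor <;> linarith [hξ.1, hξ.2]
  have hIlen : θ * h ≤ xiRight F - xiLeft F := by
    have h1 := hmemI x₀ hx₀F
    have h2 := hmemI !₂[x₀ 0, x₀ 1 + θ * h] (hx₀ _ fun i => by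
      fin_cases i <;> simp [abs_of_pos hθh, hθh.le])
    simp at h2
    linarith [h1.1, h2.2]
  have hIlt : xiLeft F < xiRight F := by linarith
  -- it is enough to control one of the two pieces
  suffices key : ∀ (β : ℝ) (p : MvPolynomial (Fin 2) ℝ) (a₀ : ℝ), βm ≤ β →
      p ∈ MvPolynomial.restrictDegree (Fin 2) ℝ m → |a₀ - x₀ 0| ≤ θ * h →
      ENNReal.ofReal β * ∫⁻ x in closedSquare a₀ (x₀ 1) (θ * h), ‖polyGrad p x‖ₑ ^ 2 ≤
        ∫⁻ x in {x : Plane | x 0 ≤ 0}, ‖Real.sqrt βm • polyGrad pm x‖ₑ ^ 2 ∂(volume.restrict F) +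
        ∫⁻ x in {x : Plane | 0 ≤ x 0}, ‖Real.sqrt βp • polyGrad pp x‖ₑ ^ 2 ∂(volume.restrict F) →
      (∀ G, (∀ i, ∀ η, |η| ≤ h → ∀ ξ ∈ Icc (xiLeft F) (xiRight F),
          |polyFun (MvPolynomial.pderiv i p) η ξ| ≤ G) →
        (∀ i, ∀ η, |η| ≤ h → ∀ ξ ∈ Icc (xiLeft F) (xiRight F),
          |polyFun (MvPolynomial.pderiv i pm) η ξ| ≤ G) ∨
        (∀ i, ∀ η, |η| ≤ h → ∀ ξ ∈ Icc (xiLeft F) (xiRight F),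
          |polyFun (MvPolynomial.pderiv i pp) η ξ| ≤ G)) →
      brokenGradNorm ((Measure.hausdorffMeasure 1).restrict (frontier F)) βm βp pm pp ≤
        ENNReal.ofReal (Real.sqrt D * (βp / Real.sqrt βm) * h ^ (-(1 / 2) : ℝ)) *
          brokenGradNorm (volume.restrict F) (Real.sqrt βm) (Real.sqrt βp) pm pp by
    have hmeas0 : MeasurableSet {x : Plane | x 0 ≤ 0} :=
      (isClosed_le (by fun_prop) (by fun_prop)).measurableSet
    have hmeas1 : MeasurableSet {x : Plane | 0 ≤ x 0} :=
      (isClosed_le (by fun_prop) (by fun_prop)).measurableSet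
    -- The square of side `θ h` is laid from `x₀` away from the interface, so it stays in one closed
    -- half-plane and the energy of a single piece controls it.
    rcases le_total (x₀ 0) 0 with hsgn | hsgn
    · refine key βm pm (x₀ 0 - θ * h) le_rfl hφ.mem_minus (by simp [abs_of_pos hθh]) ?_
        (fun G hG => .inl hG)
      refine (ofReal_mul_lintegral_le_of_square_subset hβm.le hmeas0
        (fun x hx => hx₀ x fun i => ?_) (fun x hx => ?_) pm).trans le_self_add
      · obtain ⟨⟨q1, q2⟩, q3, q4⟩ := hx
        fin_cases i <;> simp only [Fin.zero_eta, Fin.mk_one, abs_le] <;> constructor <;> linarith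
      · have := hx.1.2
        simp only [mem_ofPred_eq]
        linarith
    · refine key βp pp (x₀ 0) hβ hφ.mem_plus (by simp [hθh.le]) ?_ (fun G hG => .inr hG)
      refine (ofReal_mul_lintegral_le_of_square_subset hβp.le hmeas1
        (fun x hx => hx₀ x fun i => ?_) (fun x hx => ?_) pp).trans le_add_self
      · obtain ⟨⟨q1, q2⟩, q3, q4⟩ := hx
        fin_cases i <;> simp only [Fin.zero_eta, Fin.mk_one, abs_le] <;> constructor <;> linarith
      · exact hsgn.trans hx.1.1
  intro β p a₀ hβ' hp ha₀ hI hpG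
  have hβ0 : 0 < β := hβm.trans_le hβ'
  unfold brokenGradNorm
  generalize (∫⁻ x in {x : Plane | x 0 ≤ 0},
      ‖Real.sqrt βm • polyGrad pm x‖ₑ ^ 2 ∂(volume.restrict F) +
    ∫⁻ x in {x : Plane | 0 ≤ x 0},
      ‖Real.sqrt βp • polyGrad pp x‖ₑ ^ 2 ∂(volume.restrict F)) = N at *
  set k := Real.sqrt D * (βp / Real.sqrt βm) * h ^ (-(1 / 2) : ℝ) with hk
  have hk0 : 0 < k := by positivity
  have hk2 : k ^ 2 = D * βp ^ 2 / (βm * h) := by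
    rw [hk, mul_pow, mul_pow, div_pow, Real.sq_sqrt hD0.le, Real.sq_sqrt hβm.le,
      ← Real.rpow_natCast (h ^ (-(1 / 2) : ℝ)), ← Real.rpow_mul hh0.le]
    norm_num
    rw [Real.rpow_neg_one]
    field_simp
  have hroot : ENNReal.ofReal k * N ^ (1 / 2 : ℝ) =
      (ENNReal.ofReal (k ^ 2) * N) ^ (1 / 2 : ℝ) := by
    rw [ENNReal.mul_rpow_of_nonneg _ _ (by norm_num), ENNReal.ofReal_rpow_of_nonneg (by positivity)
      (by norm_num), ← Real.sqrt_eq_rpow, Real.sqrt_sq hk0.le]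
  rw [hroot]
  refine ENNReal.rpow_le_rpow ?_ (by norm_num)
  -- Infinite energy makes the inequality trivial. Otherwise the integral over the square is finite
  -- and defines the real bound `G`.
  rcases eq_or_ne N ⊤ with hN | hN
  · rw [hN, ENNReal.mul_top (by simpa using hk0.ne')]
    exact le_top
  set I := ∫⁻ x in closedSquare a₀ (x₀ 1) (θ * h), ‖polyGrad p x‖ₑ ^ 2 with hIdef
  have hItop : I ≠ ⊤ := by
    rintro hcon
    rw [hcon, ENNReal.mul_top (by simpa using hβ0)] at hI
    exact hN (top_le_iff.1 hI)
  set G := Real.sqrt (C₂ / (θ * h) ^ 2 * I.toReal) with hGdef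
  have hG0 : 0 ≤ G := Real.sqrt_nonneg _
  have hG2 : G ^ 2 = C₂ / (θ * h) ^ 2 * I.toReal := Real.sq_sqrt (by positivity)
  have hTr : (2 + θ + 2 * Θ) / θ * (θ * h) = (2 + θ + 2 * Θ) * h := by field_simp
  have hpbound : ∀ i, ∀ η, |η| ≤ h → ∀ ξ ∈ Icc (xiLeft F) (xiRight F),
      |polyFun (MvPolynomial.pderiv i p) η ξ| ≤ G := by
    intro i η hη ξ hξ
    refine Real.abs_le_sqrt ?_
    have h1 := hbox _ (pderiv_mem_restrictDegree hp i) a₀ (x₀ 1) (θ * h) η ξ hθh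
      (by
        rw [hTr]
        have q1 := abs_le.1 hη
        have q2 := abs_le.1 ha₀
        have q3 := abs_le.1 (hFη x₀ hx₀F)
        have : 0 < Θ * h := by positivity
        rw [abs_le]
        constructor <;> linarith)
      (by
        rw [hTr]
        have q1 := abs_le.1 (hIc ξ hξ)
        have q2 := abs_le.1 (hFc x₀ hx₀F)
        rw [abs_le]
        constructor <;> linarith)
    have h2 : ENNReal.ofReal (polyFun (MvPolynomial.pderiv i p) η ξ ^ 2) ≤
        ENNReal.ofReal (C₂ / (θ * h) ^ 2 * I.toReal) := by
      rw [ENNReal.ofReal_mul (by positivity), ENNReal.ofReal_toReal hItop]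
      exact h1.trans (
        mul_le_mul_right (lintegral_mono fun x => ofReal_polyFun_pderiv_sq_le p i x) _)
    exact (ENNReal.ofReal_le_ofReal_iff (by positivity)).1 h2
  have hY := weighted_gradient_le hφ hIlt hβm hβ hC₁.le hG0 hh0.le
    (hext h _ _ hh0 hh1 hIlen βm βp pm pp hφ) (hpG G hpbound)
  have hfr : ∀ x ∈ frontier F, |x 0| ≤ h ∧ x 1 ∈ Icc (xiLeft F) (xiRight F) := fun x hx =>
    ⟨hFη x (hclosed.frontier_subset hx), hmemI x (hclosed.frontier_subset hx)⟩
  have hmfr : MeasurableSet (frontier F) := isClosed_frontier.measurableSet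
  have hm1 := setLIntegral_weighted_polyGrad_le (μ := Measure.hausdorffMeasure 1) hmfr
    {x : Plane | x 0 ≤ 0} (p := pm) (w := βm)
    fun x hx i => (hY i _ (hfr x hx).1 _ (hfr x hx).2).1
  have hm2 := setLIntegral_weighted_polyGrad_le (μ := Measure.hausdorffMeasure 1) hmfr
    {x : Plane | 0 ≤ x 0} (p := pp) (w := βp)
    fun x hx i => (hY i _ (hfr x hx).1 _ (hfr x hx).2).2
  set Y := (C₁ + 1) * (βp * G) with hYdef
  -- `β` is the weight of the controlled piece. The worst case `β = βm` produces the factor `βp /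
  -- √βm`.
  have hkβ : D * βp ^ 2 / h ≤ k ^ 2 * β := by
    rw [hk2, div_mul_eq_mul_div, div_le_div_iff₀ hh0 (by positivity)]
    have := mul_le_mul_of_nonneg_left hβ' (by positivity : 0 ≤ D * βp ^ 2 * h)
    linarith
  calc _ ≤ ENNReal.ofReal (4 * Y ^ 2) * Measure.hausdorffMeasure 1 (frontier F) +
        ENNReal.ofReal (4 * Y ^ 2) * Measure.hausdorffMeasure 1 (frontier F) := add_le_add hm1 hm2
    _ ≤ ENNReal.ofReal (4 * Y ^ 2) * ENNReal.ofReal (Θ * h) +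
        ENNReal.ofReal (4 * Y ^ 2) * ENNReal.ofReal (Θ * h) := by gcongr
    _ = ENNReal.ofReal (D * βp ^ 2 / h) * I := by
      rw [← ENNReal.ofReal_mul (by positivity), ← ENNReal.ofReal_add (by positivity)
        (by positivity)]
      conv_rhs => rw [← ENNReal.ofReal_toReal hItop]
      rw [← ENNReal.ofReal_mul (by positivity)]
      congr 1
      rw [hYdef, mul_pow, mul_pow, hG2, hD]
      field_simp
      ring
    _ ≤ ENNReal.ofReal (k ^ 2 * β) * I := by
      gcongr
    _ = ENNReal.ofReal (k ^ 2) * (ENNReal.ofReal β * I) := by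
      rw [ENNReal.ofReal_mul (by positivity), mul_assoc]
    _ ≤ ENNReal.ofReal (k ^ 2) * N := by gcongr
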